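/- Let the atoms $\mathbb A$ be either the equality atoms $(\mathbb N,=)$, whose automorphisms are all permutations of $\mathbb N$, or the ordered atoms $(\mathbb Q,<)$, whose automorphisms are the order-preserving bijections of $\mathbb Q$. Let $\mathbb F$ be any field, on which atom automorphisms act trivially. An object on which atom automorphisms act is \emph{finitely supported} if for some finite set $s$ of atoms it is fixed by every automorphism that fixes each atom of $s$ (an \emph{$s$-automorphism}). A \emph{set with atoms} is a finitely supported set all of whose elements are finitely supported; it is \emph{orbit-finite} if, for some finite set $s$ of atoms, it is a finite union of orbits under the group of $s$-automorphisms. Let $\Sigma$ be an orbit-finite alphabet. A \emph{weighted orbit-finite automaton} over $\Sigma$ consists of an orbit-finite set $Q$ of states and finitely supported functions $I:Q\to\mathbb F$, $\delta:Q\times\Sigma\times Q\to\mathbb F$ and $F:Q\to\mathbb F$, such that $I(q)\neq 0$ for only finitely many $q$, and for all $q\in Q$ and $a\in\Sigma$ there are only finitely many $p$ with $\delta(q,a,p)\ne 0$. It recognizes the weighted language $\Sigma^*\to\mathbb F$ that maps a word $a_1\cdots a_n$ to the (finite) sum of $I(q_0)\,\delta(q_0,a_1,q_1)\cdots\delta(q_{n-1},a_n,q_n)\,F(q_n)$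 over all $(q_0,\dots,q_n)\in Q^{n+1}$. An \emph{orbit-finitely spanned automaton} over $\Sigma$ consists of an $\mathbb F$-vector space $V$ whose underlying set is a set with atoms, whose addition $V\times V\to V$ and scalar multiplication $\mathbb F\times V\to V$ are finitely supported, and which is spanned by an orbit-finite subset; a finitely supported function $\delta:V\times\Sigma\to V$ such that $v\mapsto\delta(v,a)$ is linear for every $a\in\Sigma$; an initial vector $v_0\in V$; and a finitely supported linear map $F:V\to\mathbb F$. It recognizes the weighted language that maps $a_1\cdots a_n$ to $F(v_n)$, where $v_i=\delta(v_{i-1},a_i)$ for $i=1,\dots,n$. The automaton is \emph{basic} if $V$ has an orbit-finite basis. \textbf{Theorem.} A weighted language $L:\Sigma^*\to\mathbb F$ is recognized by an orbit-finitely spanned automaton if and only if it is recognized by a weighted orbit-finite automaton. Moreover, for every orbit-finitely spanned automaton there is a basic one that recognizes the same weighted language. -/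

import Mathlib

open scoped Pointwise

universe u v

/-! ### Sets with atoms

`𝔸` is the set of atoms and `G` is the group of atom automorphisms, acting on `𝔸`.
A set with atoms is given as a finitely supported subset `S` of a type `X` on which the atom
automorphisms act, such that all elements of `S` are finitely supported. -/

namespace AtomSets

section Basic

variable (G 𝔸 : Type) [Group G] [MulAction G 𝔸]

/-- The group of `s`-automorphisms: the atom automorphisms that fix every atom from `s`. -/
def fixAtoms (s : Finset 𝔸) : Subgroup G := fixingSubgroup G (s : Set 𝔸)

/-- `x` is supported by some finite set of atoms. -/
def FinitelySupported {X : Type*} [SMul G X] (x : X) : Prop :=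
  ∃ s : Finset 𝔸, ∀ π ∈ fixAtoms G 𝔸 s, π • x = x

/-- `S` is a set with atoms: it is finitely supported (for the elementwise action on subsets), and
so are all its elements. -/
structure IsSetWithAtoms {X : Type*} [MulAction G X] (S : Set X) : Prop where
  finitelySupported : FinitelySupported G 𝔸 S
  finitelySupported_mem : ∀ x ∈ S, FinitelySupported G 𝔸 x

/-- `S` is a set with atoms which is, for some finite set `s` of atoms, a finite union of
orbits of the group of `s`-automorphisms. -/
structure IsOrbitFinite {X : Type*} [MulAction G X] (S : Set X) : Prop where
  isSetWithAtoms : IsSetWithAtoms G 𝔸 S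
  finite_union : ∃ (s : Finset 𝔸) (T : Set X), T.Finite ∧
    S = ⋃ x ∈ T, MulAction.orbit (fixAtoms G 𝔸 s) x

/-! ### Weighted orbit-finite automata -/

/-- Weighted orbit-finite automata with input alphabet `A` and weights in the field `F`. Atom
automorphisms act trivially on `F`. -/
structure WeightedAutomaton (F : Type u) [Field F] {X : Type v} [MulAction G X] (A : Set X) where
  /-- the ambient type of the states -/
  Amb : Type u
  [action : MulAction G Amb]
  /-- the states -/
  Q : Set Amb
  alphabet_orbitFinite : IsOrbitFinite G 𝔸 A
  states_orbitFinite : IsOrbitFinite G 𝔸 Q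
  /-- initial weights -/
  init : Q → F
  /-- transition weights -/
  trans : Q → A → Q → F
  /-- final weights -/
  final : Q → F
  init_finitelySupported : ∃ s : Finset 𝔸, ∀ π ∈ fixAtoms G 𝔸 s, ∀ q q' : Q,
    π • (q : Amb) = q' → init q' = init q
  trans_finitelySupported : ∃ s : Finset 𝔸, ∀ π ∈ fixAtoms G 𝔸 s, ∀ (q q' : Q) (a a' : A)
    (p p' : Q), π • (q : Amb) = q' → π • (a : X) = a' → π • (p : Amb) = p' →
      trans q' a' p' = trans q a p
  final_finitelySupported : ∃ s : Finset 𝔸, ∀ π ∈ fixAtoms G 𝔸 s, ∀ q q' : Q,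
    π • (q : Amb) = q' → final q' = final q
  /-- the non-guessing condition -/
  init_finite : {q | init q ≠ 0}.Finite
  trans_finite : ∀ q a, {p | trans q a p ≠ 0}.Finite

namespace WeightedAutomaton

variable {G 𝔸} {F : Type u} [Field F] {X : Type v} [MulAction G X] {A : Set X}

/-- The weight of the run `ρ 0, ρ 1, …, ρ n` over the word `w` of length `n`. -/
def runWeight (W : WeightedAutomaton G 𝔸 F A) (w : List A) (ρ : Fin (w.length + 1) → W.Q) : F :=
  W.init (ρ 0) * (∏ i : Fin w.length, W.trans (ρ i.castSucc) (w.get i) (ρ i.succ)) *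
    W.final (ρ (Fin.last w.length))

/-- The non-guessing condition makes the sum in `language` a finite one. -/
theorem runWeight_support_finite (W : WeightedAutomaton G 𝔸 F A) (w : List A) :
    (Function.support (W.runWeight w)).Finite := by
  have key : ∀ (n : ℕ) (a : Fin n → A), {ρ : Fin (n + 1) → W.Q | W.init (ρ 0) ≠ 0 ∧
      ∀ i : Fin n, W.trans (ρ i.castSucc) (a i) (ρ i.succ) ≠ 0}.Finite := by
    intro n
    induction n with
    | zero =>
      intro a
      refine Set.Finite.of_injOn (f := fun ρ : Fin 1 → W.Q => ρ 0) (fun ρ h => h.1) ?_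
        W.init_finite
      intro ρ _ ρ' _ h
      funext i
      rw [Subsingleton.elim i 0]
      exact h
    | succ n ih =>
      intro a
      have h := (ih (fun i => a i.castSucc)).biUnion (t := fun ρ =>
        (fun p => (Fin.snoc ρ p : Fin (n + 1 + 1) → W.Q)) ''
          {p | W.trans (ρ (Fin.last n)) (a (Fin.last n)) p ≠ 0})
        (fun ρ _ => (W.trans_finite _ _).image _)
      refine h.subset ?_
      rintro ρ ⟨h0, h1⟩
      refine Set.mem_biUnion (x := Fin.init ρ) ⟨h0, fun i => ?_⟩
        ⟨ρ (Fin.last (n + 1)), ?_, Fin.snoc_init_self ρ⟩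
      · exact h1 i.castSucc
      · exact h1 (Fin.last n)
  refine (key w.length w.get).subset ?_
  intro ρ hρ
  have hne : W.runWeight w ρ ≠ 0 := hρ
  unfold runWeight at hne
  have h1 := left_ne_zero_of_mul hne
  exact ⟨left_ne_zero_of_mul h1, fun i =>
    Finset.prod_ne_zero_iff.1 (right_ne_zero_of_mul h1) i (Finset.mem_univ i)⟩

/-- The recognized weighted language: a word is mapped to the sum of the weights of all runs. -/
noncomputable def language (W : WeightedAutomaton G 𝔸 F A) (w : List A) : F :=
  ∑ᶠ ρ : Fin (w.length + 1) → W.Q, W.runWeight w ρ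

end WeightedAutomaton

/-! ### Orbit-finitely spanned automata -/

/-- The vector space `V` over `F` is a vector space with atoms: its underlying set is a set with
atoms, and addition `V × V → V` and scalar multiplication `F × V → V` are finitely supported. -/
structure IsVectorSpaceWithAtoms (F : Type u) [Field F] {Y : Type u} [MulAction G Y] (V : Set Y)
    [AddCommGroup V] [Module F V] : Prop where
  isSetWithAtoms : IsSetWithAtoms G 𝔸 V
  add_finitelySupported : ∃ s : Finset 𝔸, ∀ π ∈ fixAtoms G 𝔸 s, ∀ x x' y y' : V,
    π • (x : Y) = x' → π • (y : Y) = y' → π • ((x + y : V) : Y) = (x' + y' : V)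
  smul_finitelySupported : ∃ s : Finset 𝔸, ∀ π ∈ fixAtoms G 𝔸 s, ∀ (c : F) (x x' : V),
    π • (x : Y) = x' → π • ((c • x : V) : Y) = (c • x' : V)

/-- A vector space with atoms that is spanned by an orbit-finite subset. -/
structure IsOrbitFinitelySpanned (F : Type u) [Field F] {Y : Type u} [MulAction G Y] (V : Set Y)
    [AddCommGroup V] [Module F V] : Prop where
  isVectorSpaceWithAtoms : IsVectorSpaceWithAtoms G 𝔸 F V
  spanned : ∃ S : Set V, IsOrbitFinite G 𝔸 (Subtype.val '' S) ∧ Submodule.span F S = ⊤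

/-- Orbit-finitely spanned automata with input alphabet `A` over the field `F`. -/
structure SpannedAutomaton (F : Type u) [Field F] {X : Type v} [MulAction G X] (A : Set X) where
  /-- the ambient type of the state space -/
  Amb : Type u
  [action : MulAction G Amb]
  /-- the state space -/
  V : Set Amb
  [addCommGroup : AddCommGroup V]
  [module : Module F V]
  alphabet_orbitFinite : IsOrbitFinite G 𝔸 A
  orbitFinitelySpanned : IsOrbitFinitelySpanned G 𝔸 F V
  /-- the transition function `V × A → V`, linear for every fixed letter -/
  trans : A → V →ₗ[F] V
  trans_finitelySupported : ∃ s : Finset 𝔸, ∀ π ∈ fixAtoms G 𝔸 s, ∀ (x x' : V) (a a' : A),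
    π • (x : Amb) = x' → π • (a : X) = a' → π • (trans a x : Amb) = trans a' x'
  /-- the initial vector -/
  init : V
  /-- the final function -/
  final : V →ₗ[F] F
  final_finitelySupported : ∃ s : Finset 𝔸, ∀ π ∈ fixAtoms G 𝔸 s, ∀ x x' : V,
    π • (x : Amb) = x' → final x' = final x

attribute [instance] WeightedAutomaton.action SpannedAutomaton.action
  SpannedAutomaton.addCommGroup SpannedAutomaton.module

namespace SpannedAutomaton

variable {G 𝔸} {F : Type u} [Field F] {X : Type v} [MulAction G X] {A : Set X}

/-- The recognized weighted language: starting in the initial vector, apply the transition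
functions of the consecutive letters of the word, and then the final function. -/
def language (M : SpannedAutomaton G 𝔸 F A) (w : List A) : F :=
  M.final (w.foldl (fun x a => M.trans a x) M.init)

/-- The state space has an orbit-finite basis. -/
def IsBasic (M : SpannedAutomaton G 𝔸 F A) : Prop :=
  ∃ B : Set M.V, IsOrbitFinite G 𝔸 (Subtype.val '' B) ∧
    LinearIndependent F (fun b : B => (b : M.V)) ∧ Submodule.span F B = ⊤

end SpannedAutomaton

end Basic

end AtomSets

namespace AtomSets

/-! ### Homogeneous actions -/

/-- `u` supports `x` with respect to the group `Γ` acting on the atoms. -/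
def Supports (Γ : Type*) {𝔸 X : Type*} [SMul Γ 𝔸] [SMul Γ X] (u : Finset 𝔸) (x : X) : Prop :=
  ∀ π : Γ, (∀ a ∈ u, π • a = a) → π • x = x

/-- The atoms `x` and `y` are in the same relation to all atoms from `D`. -/
def SameType {𝔸 : Type*} (R : 𝔸 → 𝔸 → Prop) (D : Finset 𝔸) (x y : 𝔸) : Prop :=
  ∀ d ∈ D, (R d x ↔ R d y) ∧ (R x d ↔ R y d)

/-- The group `Γ` acts on the atoms as the automorphism group of the partial order `R` with
constants from `s`, this order is homogeneous, and it has enough atoms of every type. -/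
structure Homogeneous (Γ : Type*) {𝔸 : Type*} [Group Γ] [MulAction Γ 𝔸] (R : 𝔸 → 𝔸 → Prop)
    (s : Finset 𝔸) : Prop where
  refl : ∀ x, R x x
  trans : ∀ x y z, R x y → R y z → R x z
  antisymm : ∀ x y, R x y → R y x → x = y
  symm_or_total : (∀ x y, R x y → R y x) ∨ ∀ x y, R x y ∨ R y x
  smul_rel : ∀ (π : Γ) (x y : 𝔸), R (π • x) (π • y) ↔ R x y
  smul_const : ∀ (π : Γ), ∀ x ∈ s, π • x = x
  extend : ∀ (D : Finset 𝔸) (x y : 𝔸), s ⊆ D → SameType R D x y →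
    ∃ σ : Γ, (∀ d ∈ D, σ • d = d) ∧ σ • x = y
  -- For equality, `z` avoids `t`; for the order, `z` lies in the gap of `y` in `D`, above all atoms
  -- of `t` in that gap.
  exists_fresh : ∀ (D t : Finset 𝔸) (y : 𝔸), y ∉ D → ∃ z, SameType R D y z ∧
    ∀ x ∈ t, R z x → ∃ d ∈ D, R z d ∧ R d x
  -- The atom `z` cannot tell `x` from `y`, so an automorphism may fix `z` while taking `x` to `y`.
  exists_shift : ∀ (D : Finset 𝔸) (x y : 𝔸), x ∉ D → ∃ z, SameType R D x z ∧
    (R z x ↔ R z y) ∧ (R x z ↔ R y z)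

section Homogeneous

variable {Γ 𝔸 : Type*} [Group Γ] [MulAction Γ 𝔸]

theorem Supports.mono {X : Type*} [SMul Γ X] {u u' : Finset 𝔸} {x : X} (h : Supports Γ u x)
    (hu : u ⊆ u') : Supports Γ u' x :=
  fun π hπ => h π fun a ha => hπ a (hu ha)

variable [DecidableEq 𝔸]

theorem Supports.smul {X : Type*} [MulAction Γ X] {u : Finset 𝔸} {x : X} (h : Supports Γ u x)
    (g : Γ) : Supports Γ (g • u) (g • x) := by
  intro π hπ
  have h1 := h (g⁻¹ * π * g) (fun a ha => by
    have := hπ (g • a) (Finset.smul_mem_smul_finset ha)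
    rw [mul_smul, mul_smul, this, inv_smul_smul])
  rw [mul_smul, mul_smul, inv_smul_eq_iff] at h1
  exact h1

variable {R : 𝔸 → 𝔸 → Prop} {s : Finset 𝔸}

namespace Homogeneous

/-- One-point extension, iterated: targets already reached join the constants for the next step. -/
theorem exists_smul_eq (H : Homogeneous Γ R s) {ι : Type*} [Finite ι] (x y : ι → 𝔸)
    {D : Finset 𝔸} (hs : s ⊆ D) (h : ∀ i j, R (x i) (x j) ↔ R (y i) (y j))
    (hD : ∀ i, SameType R D (x i) (y i)) :
    ∃ σ : Γ, (∀ d ∈ D, σ • d = d) ∧ ∀ i, σ • x i = y i := by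
  classical
  have := Fintype.ofFinite ι
  suffices ∀ J : Finset ι, ∃ σ : Γ, (∀ d ∈ D, σ • d = d) ∧ ∀ i ∈ J, σ • x i = y i by
    obtain ⟨σ, h1, h2⟩ := this Finset.univ
    exact ⟨σ, h1, fun i => h2 i (Finset.mem_univ i)⟩
  intro J
  induction J using Finset.induction_on with
  | empty => exact ⟨1, by simp, by simp⟩
  | insert i J _ ih =>
    obtain ⟨σ, h1, h2⟩ := ih
    obtain ⟨ρ, h3, h4⟩ := H.extend (D ∪ J.image y) (σ • x i) (y i)
      (hs.trans Finset.subset_union_left) (by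
        intro d hd
        rcases Finset.mem_union.1 hd with hd | hd
        · have e1 := H.smul_rel σ d (x i)
          have e2 := H.smul_rel σ (x i) d
          rw [h1 d hd] at e1 e2
          exact ⟨e1.trans (hD i d hd).1, e2.trans (hD i d hd).2⟩
        · obtain ⟨j, hj, rfl⟩ := Finset.mem_image.1 hd
          rw [← h, ← h, ← h2 j hj, H.smul_rel, H.smul_rel]
          exact ⟨Iff.rfl, Iff.rfl⟩)
    refine ⟨ρ * σ, fun d hd => ?_, fun j hj => ?_⟩
    · rw [mul_smul, h1 d hd, h3 d (Finset.mem_union_left _ hd)]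
    · rw [mul_smul]
      rcases Finset.mem_insert.1 hj with rfl | hj
      · exact h4
      · rw [h2 j hj, h3 _ (Finset.mem_union_right _ (Finset.mem_image_of_mem _ hj))]

/-- There are finitely many tuples of atoms up to automorphisms fixing `D`. -/
theorem exists_finite_tuples (H : Homogeneous Γ R s) {ι : Type*} [Finite ι] (D : Finset 𝔸)
    (Z : Set (ι → 𝔸)) : ∃ T : Set (ι → 𝔸), T.Finite ∧ T ⊆ Z ∧ ∀ x ∈ Z, ∃ y ∈ T, ∃ σ : Γ,
      (∀ d ∈ D, σ • d = d) ∧ ∀ i, σ • y i = x i := by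
  classical
  have hfin : Finite ↥(D ∪ s) := inferInstance
  -- The relations inside a tuple and with `D ∪ s` determine its orbit, and only finitely many
  -- patterns exist.
  let pat : (ι → 𝔸) → (ι → ι → Prop) × (ι → ↥(D ∪ s) → Prop × Prop) :=
    fun x => (fun i j => R (x i) (x j), fun i d => (R d (x i), R (x i) d))
  have hpat : (pat '' Z).Finite := Set.toFinite _
  obtain ⟨T, hTZ, hT, hTim⟩ := Set.exists_subset_bijOn Z pat |>.imp fun T h =>
    (⟨h.1, Set.Finite.of_finite_image (h.2.image_eq ▸ hpat) h.2.injOn, h.2.image_eq⟩ :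
      T ⊆ Z ∧ T.Finite ∧ pat '' T = pat '' Z)
  refine ⟨T, hT, hTZ, fun x hx => ?_⟩
  obtain ⟨y, hy, hxy⟩ : pat x ∈ pat '' T := hTim ▸ Set.mem_image_of_mem _ hx
  obtain ⟨σ, h1, h2⟩ := H.exists_smul_eq y x (D := D ∪ s) Finset.subset_union_right
    (fun i j => by
      have := congrFun (congrFun (congrArg Prod.fst hxy) i) j
      exact iff_of_eq this)
    (fun i d hd => by
      have := congrFun (congrFun (congrArg Prod.snd hxy) i) ⟨d, hd⟩
      exact ⟨iff_of_eq (congrArg Prod.fst this), iff_of_eq (congrArg Prod.snd this)⟩)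
  exact ⟨y, hy, σ, fun d hd => h1 d (Finset.mem_union_left _ hd), h2⟩

/-- The element `g • x` depends only on the tuple of the `g • a` with `a ∈ u`, which reduces the
claim to tuples of atoms. -/
theorem exists_finite_orbit_reps (H : Homogeneous Γ R s) {X : Type*} [MulAction Γ X] {x : X}
    {u : Finset 𝔸} (hu : Supports Γ u x) (D : Finset 𝔸) (Z : Set X)
    (hZ : Z ⊆ MulAction.orbit Γ x) : ∃ T : Set X, T.Finite ∧ T ⊆ Z ∧ ∀ z ∈ Z, ∃ y ∈ T, ∃ σ : Γ,
      (∀ d ∈ D, σ • d = d) ∧ z = σ • y := by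
  have hZ' : ∀ z ∈ Z, ∃ g : Γ, g • x = z := fun z hz => hZ hz
  choose! g hg using hZ'
  obtain ⟨T, hT, hTZ, h⟩ := H.exists_finite_tuples (ι := u) D ((fun z (a : u) => g z • (a : 𝔸)) '' Z)
  have hTZ' : ∀ y ∈ T, ∃ z ∈ Z, (fun a : u => g z • (a : 𝔸)) = y := fun y hy => hTZ hy
  have : Nonempty X := ⟨x⟩
  choose! f hf using hTZ'
  refine ⟨f '' T, hT.image f, ?_, fun z hz => ?_⟩
  · rintro _ ⟨y, hy, rfl⟩
    exact (hf y hy).1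
  · obtain ⟨y, hy, σ, h1, h2⟩ := h _ (Set.mem_image_of_mem _ hz)
    refine ⟨f y, Set.mem_image_of_mem _ hy, σ, h1, ?_⟩
    obtain ⟨h3, h4⟩ := hf y hy
    have h5 := hu ((g z)⁻¹ * σ * g (f y)) (fun a ha => by
      rw [mul_smul, mul_smul, inv_smul_eq_iff]
      have := h2 ⟨a, ha⟩
      rw [← h4] at this
      exact this)
    rw [mul_smul, mul_smul, inv_smul_eq_iff, hg _ hz, hg _ h3] at h5
    exact h5.symm

/-- An atom which is not in some support can be removed from any other support. -/
theorem supports_erase (H : Homogeneous Γ R s) {X : Type*} [MulAction Γ X] {x : X}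
    {t t' : Finset 𝔸} (h : Supports Γ t x) (h' : Supports Γ t' x) {a : 𝔸} (ha : a ∉ t') :
    Supports Γ (t.erase a) x := by
  intro π hπ
  by_cases has : a ∈ s
  · refine h π fun b hb => ?_
    by_cases hba : b = a
    · exact hba ▸ H.smul_const π a has
    · exact hπ b (Finset.mem_erase.2 ⟨hba, hb⟩)
  -- The automorphism `g` parks `a` at `z` while fixing `t'`, hence `x`. Then `k` takes `a` to `π •
  -- a` but fixes `z`, so `g⁻¹ * k * g` fixes `t` and `k` fixes `x`. Since `k` and `π` agree on `t`,
  -- also `π` fixes `x`.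
  obtain ⟨z, hz, hz1, hz2⟩ := H.exists_shift (t' ∪ t.erase a ∪ s) a (π • a) (by simp [ha, has])
  obtain ⟨g, hg, hgz⟩ := H.extend _ a z Finset.subset_union_right hz
  obtain ⟨k, hk, hka⟩ := H.extend (insert z (t.erase a ∪ s)) a (π • a)
    (Finset.subset_union_right.trans (Finset.subset_insert _ _)) (by
      intro d hd
      rcases Finset.mem_insert.1 hd with rfl | hd
      · exact ⟨hz1, hz2⟩
      · have : π • d = d := by
          rcases Finset.mem_union.1 hd with hd | hd
          · exact hπ d hd
          · exact H.smul_const π d hd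
        rw [← H.smul_rel π d a, ← H.smul_rel π a d, this]
        exact ⟨Iff.rfl, Iff.rfl⟩)
  have hgx : g • x = x := h' g fun b hb => hg b (by simp [hb])
  have hkx : k • x = x := by
    have := h (g⁻¹ * k * g) (fun b hb => by
      rw [mul_smul, mul_smul, inv_smul_eq_iff]
      by_cases hba : b = a
      · rw [hba, hgz, hk z (Finset.mem_insert_self _ _)]
      · have hb' : b ∈ t.erase a := Finset.mem_erase.2 ⟨hba, hb⟩
        rw [hg b (by simp only [Finset.mem_union]; tauto), hk b (by
          simp only [Finset.mem_union, Finset.mem_insert]; tauto)])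
    rwa [mul_smul, mul_smul, inv_smul_eq_iff, hgx] at this
  have := h (k⁻¹ * π) (fun b hb => by
    rw [mul_smul, inv_smul_eq_iff]
    by_cases hba : b = a
    · rw [hba, hka]
    · have hb' : b ∈ t.erase a := Finset.mem_erase.2 ⟨hba, hb⟩
      rw [hπ b hb', hk b (by simp only [Finset.mem_union, Finset.mem_insert]; tauto)])
  rwa [mul_smul, inv_smul_eq_iff, hkx] at this

/-- There is a support which is fixed by all automorphisms that fix `x`. -/
theorem exists_least_support (H : Homogeneous Γ R s) {X : Type*} [MulAction Γ X] {x : X}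
    (h : ∃ t : Finset 𝔸, Supports Γ t x) :
    ∃ t : Finset 𝔸, Supports Γ t x ∧ ∀ π : Γ, π • x = x → π • t = t := by
  classical
  obtain ⟨t, ht, hmin⟩ := WellFounded.has_min (measure (Finset.card (α := 𝔸))).wf
    {t : Finset 𝔸 | Supports Γ t x} h
  refine ⟨t, ht, fun π hπ => ?_⟩
  have hπt : Supports Γ (π • t) x := by
    have := Supports.smul ht π
    rwa [hπ] at this
  refine (Finset.eq_of_subset_of_card_le (fun a ha => ?_) (by simp)).symm
  by_contra hat
  exact hmin _ (H.supports_erase ht hπt hat) (Finset.card_erase_lt_of_mem ha)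

end Homogeneous

/-! ### Generic automorphisms -/

/-- `τ` fixes `D` and moves `u` away from `t`, as much as fixing `D` permits. -/
def IsGeneric (R : 𝔸 → 𝔸 → Prop) (s D t u : Finset 𝔸) (τ : Γ) : Prop :=
  (∀ d ∈ D, τ • d = d) ∧ ∀ y ∈ u, ∀ x ∈ t, R (τ • y) x → ∃ d ∈ D ∪ s, R (τ • y) d ∧ R d x

theorem IsGeneric.mono {D t u u' : Finset 𝔸} {τ : Γ} (h : IsGeneric R s D t u τ) (hu : u' ⊆ u) :
    IsGeneric R s D t u' τ :=
  ⟨h.1, fun y hy => h.2 y (hu hy)⟩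

namespace Homogeneous

theorem exists_isGeneric (H : Homogeneous Γ R s) (D t u : Finset 𝔸) :
    ∃ τ : Γ, IsGeneric R s D t u τ := by
  induction u using Finset.induction_on with
  | empty => exact ⟨1, by simp, by simp⟩
  | insert y u _ ih =>
    obtain ⟨τ, h1, h2⟩ := ih
    by_cases hy : τ • y ∈ D ∪ s ∪ τ • u
    · refine ⟨τ, h1, fun y' hy' x hx hR => ?_⟩
      rcases Finset.mem_insert.1 hy' with rfl | hy'
      · rcases Finset.mem_union.1 hy with hy | hy
        · exact ⟨_, hy, H.refl _, hR⟩
        · obtain ⟨y'', h3, h4⟩ := Finset.mem_smul_finset.1 hy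
          rw [← h4] at hR ⊢
          exact h2 y'' h3 x hx hR
      · exact h2 y' hy' x hx hR
    -- Freshness is taken over the images placed so far as well, so that moving `y` leaves them
    -- alone; a witness among those images is traded for one in `D ∪ s` by transitivity.
    · obtain ⟨z, hz, hzt⟩ := H.exists_fresh _ t _ hy
      obtain ⟨σ, h3, h4⟩ := H.extend _ _ z (by
        rw [Finset.union_assoc, Finset.union_left_comm]
        exact Finset.subset_union_left) hz
      have h5 : ∀ y' ∈ u, (σ * τ) • y' = τ • y' := fun y' hy' => by
        rw [mul_smul, h3]
        exact Finset.mem_union_right _ (Finset.smul_mem_smul_finset hy')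
      refine ⟨σ * τ, fun d hd => ?_, fun y' hy' x hx hR => ?_⟩
      · rw [mul_smul, h1 d hd, h3 d (by simp [hd])]
      · rcases Finset.mem_insert.1 hy' with rfl | hy'
        · rw [mul_smul, h4] at hR ⊢
          obtain ⟨d, hd, h6, h7⟩ := hzt x hx hR
          rcases Finset.mem_union.1 hd with hd | hd
          · exact ⟨d, hd, h6, h7⟩
          · obtain ⟨y'', h8, rfl⟩ := Finset.mem_smul_finset.1 hd
            obtain ⟨d, h9, h10, h11⟩ := h2 y'' h8 x hx h7
            exact ⟨d, h9, H.trans _ _ _ h6 h10, h11⟩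
        · rw [h5 y' hy'] at hR ⊢
          exact h2 y' hy' x hx hR

/-- The relation factors through an atom `d` that both automorphisms fix, so it depends on `y` and
not on the automorphism. -/
theorem rel_of_isGeneric (H : Homogeneous Γ R s) {D t u : Finset 𝔸} {τ τ' : Γ}
    (h : IsGeneric R s D t u τ) (h' : IsGeneric R s D t u τ') {y x : 𝔸} (hy : y ∈ u) (hx : x ∈ t)
    (hR : R (τ • y) x) : R (τ' • y) x := by
  obtain ⟨d, hd, h1, h2⟩ := h.2 y hy x hx hR
  have hτ : τ • d = d := (Finset.mem_union.1 hd).elim (h.1 d) (H.smul_const τ d)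
  have hτ' : τ' • d = d := (Finset.mem_union.1 hd).elim (h'.1 d) (H.smul_const τ' d)
  rw [← hτ, H.smul_rel, ← H.smul_rel τ', hτ'] at h1
  exact H.trans _ _ _ h1 h2

/-- Genericity is one-sided. In a total order, failure for `τ'` gives the opposite inequality for
`τ'`, hence for `τ`; then `τ • y = x` is a constant fixed by both. -/
theorem rel_of_isGeneric' (H : Homogeneous Γ R s) {D t u : Finset 𝔸} {τ τ' : Γ}
    (h : IsGeneric R s D t u τ) (h' : IsGeneric R s D t u τ') {y x : 𝔸} (hy : y ∈ u) (hx : x ∈ t)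
    (hR : R x (τ • y)) : R x (τ' • y) := by
  rcases H.symm_or_total with hs | hs
  · exact hs _ _ (H.rel_of_isGeneric h h' hy hx (hs _ _ hR))
  · rcases hs x (τ' • y) with hR' | hR'
    · exact hR'
    have h1 := H.rel_of_isGeneric h' h hy hx hR'
    obtain ⟨d, hd, h2, h3⟩ := h.2 y hy x hx h1
    obtain rfl : d = x := H.antisymm _ _ h3 (H.trans _ _ _ hR h2)
    have hτ : τ • d = d := (Finset.mem_union.1 hd).elim (h.1 d) (H.smul_const τ d)
    have hτ' : τ' • d = d := (Finset.mem_union.1 hd).elim (h'.1 d) (H.smul_const τ' d)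
    have h4 : τ • y = d := H.antisymm _ _ h1 hR
    rw [← hτ, smul_left_cancel_iff] at h4
    rw [h4, hτ']
    exact H.refl _

/-- This makes the value of a functional supported by `t` on a generically moved vector independent
of the move. -/
theorem exists_smul_eq_of_isGeneric (H : Homogeneous Γ R s) {D t u : Finset 𝔸} {τ τ' : Γ}
    (h : IsGeneric R s D t u τ) (h' : IsGeneric R s D t u τ') :
    ∃ κ : Γ, (∀ x ∈ t, κ • x = x) ∧ ∀ y ∈ u, (κ * τ) • y = τ' • y := by
  obtain ⟨κ, h1, h2⟩ := H.exists_smul_eq (fun y : u => τ • (y : 𝔸)) (fun y : u => τ' • (y : 𝔸))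
    (D := t ∪ s) Finset.subset_union_right (fun i j => by rw [H.smul_rel, H.smul_rel])
    (fun y x hx => by
      rcases Finset.mem_union.1 hx with hx | hx
      · exact ⟨⟨H.rel_of_isGeneric' h h' y.2 hx, H.rel_of_isGeneric' h' h y.2 hx⟩,
          ⟨H.rel_of_isGeneric h h' y.2 hx, H.rel_of_isGeneric h' h y.2 hx⟩⟩
      · have h1 := H.smul_const τ x hx
        have h2 := H.smul_const τ' x hx
        have e1 := H.smul_rel τ x y
        have e2 := H.smul_rel τ y x
        have e3 := H.smul_rel τ' x y
        have e4 := H.smul_rel τ' y x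
        rw [h1] at e1 e2
        rw [h2] at e3 e4
        exact ⟨e1.trans e3.symm, e2.trans e4.symm⟩)
  exact ⟨κ, fun x hx => h1 x (Finset.mem_union_left _ hx), fun y hy => by
    rw [mul_smul]; exact h2 ⟨y, hy⟩⟩

end Homogeneous

end Homogeneous

/-! ### Generic parts of functionals and the vanishing of their alternating sums -/

section GenericPart

variable {Γ 𝔸 F V : Type*} [Group Γ] [MulAction Γ 𝔸] [DecidableEq 𝔸] [Field F] [AddCommGroup V]
  [Module F V] [DistribMulAction Γ V] {R : 𝔸 → 𝔸 → Prop} {s : Finset 𝔸}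

/-- `ψ` is obtained from the functional `φ` with support `t` by making all atoms of `t` that are
not in `D` generic. -/
def IsGenericPart (Γ : Type*) [Group Γ] [MulAction Γ 𝔸] [DistribMulAction Γ V]
    (R : 𝔸 → 𝔸 → Prop) (s D t : Finset 𝔸) (φ ψ : Module.Dual F V) : Prop :=
  ∀ (v : V) (u : Finset 𝔸) (τ : Γ), Supports Γ u v → IsGeneric R s D t u τ → ψ v = φ (τ • v)

/-- Functionals with a large support are combinations of their generic parts. -/
theorem Homogeneous.sum_isGenericPart_eq_zero (H : Homogeneous Γ R s) {k : ℕ}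
    (hk : Submodule.span F {v : V | ∃ u : Finset 𝔸, u.card ≤ k ∧ Supports Γ u v} = ⊤)
    {E I t : Finset 𝔸}
    (hI : ∀ u : Finset 𝔸, u.card ≤ k → ∃ x ∈ I, ∀ y ∈ u, R y x →
      ∃ d ∈ (E \ I) ∪ s, R y d ∧ R d x)
    {φ : Module.Dual F V} {g : Finset 𝔸 → Module.Dual F V}
    (hg : ∀ D, IsGenericPart Γ R s D t φ (g D)) :
    ∑ J ∈ I.powerset, (-1 : F) ^ J.card • g (E \ J) = 0 := by
  rw [← LinearMap.ker_eq_top, eq_top_iff, ← hk, Submodule.span_le]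
  rintro v ⟨u, huk, hu⟩
  obtain ⟨x, hxI, hx⟩ := hI u huk
  -- The terms of `J` and `insert x J` have opposite signs and cancel at `v`: one `τ` is generic for
  -- both sets, since a separating atom equal to `x` can be replaced by the `d'` that `hx` provides.
  have key : ∀ J ∈ (I.erase x).powerset, g (E \ J) v = g (E \ insert x J) v := by
    intro J hJ
    have hJ' : x ∉ J := fun h => Finset.notMem_erase x I (Finset.mem_powerset.1 hJ h)
    have hJI : J ⊆ I := (Finset.mem_powerset.1 hJ).trans (Finset.erase_subset _ _)
    have hsub : E \ insert x J ⊆ E \ J :=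
      Finset.sdiff_subset_sdiff le_rfl (Finset.subset_insert _ _)
    obtain ⟨τ, h1, h2⟩ := H.exists_isGeneric (E \ J) t u
    rw [hg _ v u τ hu ⟨h1, h2⟩, hg _ v u τ hu ⟨fun d hd => h1 d (hsub hd), ?_⟩]
    intro y hy z hz hR
    obtain ⟨d, hd, h3, h4⟩ := h2 y hy z hz hR
    by_cases hdx : d = x
    · subst hdx
      have hd' : τ • d = d := (Finset.mem_union.1 hd).elim (h1 d) (H.smul_const τ d)
      rw [← hd', H.smul_rel] at h3
      obtain ⟨d', h5, h6, h7⟩ := hx y hy h3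
      have hd'' : τ • d' = d' := (Finset.mem_union.1 h5).elim
        (fun h => h1 d' (Finset.sdiff_subset_sdiff le_rfl hJI h)) (H.smul_const τ d')
      refine ⟨d', ?_, ?_, H.trans _ _ _ h7 h4⟩
      · exact Finset.union_subset_union_left (Finset.sdiff_subset_sdiff le_rfl
          (Finset.insert_subset hxI hJI)) h5
      · rwa [← hd'', H.smul_rel]
    · refine ⟨d, ?_, h3, h4⟩
      simp only [Finset.mem_union, Finset.mem_sdiff, Finset.mem_insert] at hd ⊢
      tauto
  rw [SetLike.mem_coe, LinearMap.mem_ker, ← Finset.insert_erase hxI,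
    Finset.sum_powerset_insert (Finset.notMem_erase x I), LinearMap.add_apply,
    LinearMap.sum_apply, LinearMap.sum_apply, ← Finset.sum_add_distrib]
  refine Finset.sum_eq_zero fun J hJ => ?_
  have hJ' : x ∉ J := fun h => Finset.notMem_erase x I (Finset.mem_powerset.1 hJ h)
  rw [LinearMap.smul_apply, LinearMap.smul_apply, key J hJ, Finset.card_insert_of_notMem hJ',
    pow_succ]
  simp

end GenericPart

/-! ### The contragredient action and supports of functionals -/

section Dual

variable {Γ 𝔸 F V : Type*} [Group Γ] [MulAction Γ 𝔸] [Field F] [AddCommGroup V]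
  [Module F V] [DistribMulAction Γ V] [SMulCommClass Γ F V]

/-- The contragredient action on linear functionals. -/
instance dualMulAction : MulAction Γ (Module.Dual F V) where
  smul π φ := φ ∘ₗ DistribSMul.toLinearMap F V π⁻¹
  one_smul φ := LinearMap.ext fun v => congrArg φ (by simp)
  mul_smul π ρ φ := LinearMap.ext fun v => congrArg φ (by simp [mul_smul])

theorem dual_smul_apply (π : Γ) (φ : Module.Dual F V) (v : V) : (π • φ) v = φ (π⁻¹ • v) := rfl

variable (F V) in
/-- The linear functionals which are fixed by all elements of `S`. -/
def fixedDual (S : Set Γ) : Submodule F (Module.Dual F V) where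
  carrier := {φ | ∀ π ∈ S, π • φ = φ}
  add_mem' {φ ψ} hφ hψ π hπ := by
    ext v
    have h1 := LinearMap.congr_fun (hφ π hπ) v
    have h2 := LinearMap.congr_fun (hψ π hπ) v
    rw [dual_smul_apply] at h1 h2 ⊢
    rw [LinearMap.add_apply, h1, h2, LinearMap.add_apply]
  zero_mem' π _ := by
    ext v
    rfl
  smul_mem' c φ hφ π hπ := by
    ext v
    have h1 := LinearMap.congr_fun (hφ π hπ) v
    rw [dual_smul_apply] at h1 ⊢
    rw [LinearMap.smul_apply, h1, LinearMap.smul_apply]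

variable (Γ F V) in
/-- The linear functionals which are supported by `D`. -/
def supportedDual (D : Finset 𝔸) : Submodule F (Module.Dual F V) :=
  fixedDual F V {π : Γ | ∀ d ∈ D, π • d = d}

theorem Supports.dual_apply {D : Finset 𝔸} {φ : Module.Dual F V} (h : Supports Γ D φ) {π : Γ}
    (hπ : ∀ d ∈ D, π • d = d) (v : V) : φ (π • v) = φ v := by
  have := LinearMap.congr_fun (h π⁻¹ fun a ha => by rw [inv_smul_eq_iff, hπ a ha]) v
  rwa [dual_smul_apply, inv_inv] at this

theorem supports_dual_iff {D : Finset 𝔸} {φ : Module.Dual F V} :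
    Supports Γ D φ ↔ ∀ π : Γ, (∀ d ∈ D, π • d = d) → ∀ v, φ (π • v) = φ v := by
  refine ⟨fun h π hπ v => h.dual_apply hπ v, fun h π hπ => ?_⟩
  ext v
  rw [dual_smul_apply]
  exact h _ (fun d hd => by rw [inv_smul_eq_iff, hπ d hd]) v

theorem supportedDual_mono {D D' : Finset 𝔸} (h : D ⊆ D') :
    supportedDual Γ F V D ≤ supportedDual Γ F V D' :=
  fun _ hφ => Supports.mono hφ h

variable [DecidableEq 𝔸] {R : 𝔸 → 𝔸 → Prop} {s : Finset 𝔸}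

namespace Homogeneous

/-- Independence of the generic move makes the value well defined; additivity follows by using one
move for the union of two supports, and support by `D` by precomposing the move with an automorphism
fixing `D`. -/
theorem exists_isGenericPart (H : Homogeneous Γ R s)
    (hfs : ∀ v : V, ∃ u : Finset 𝔸, Supports Γ u v)
    {t : Finset 𝔸} {φ : Module.Dual F V} (hφ : Supports Γ t φ)
    (D : Finset 𝔸) :
    ∃ ψ : Module.Dual F V, Supports Γ D ψ ∧ IsGenericPart Γ R s D t φ ψ := by
  have key : ∀ (v : V) (u : Finset 𝔸) (τ τ' : Γ), Supports Γ u v → IsGeneric R s D t u τ →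
      IsGeneric R s D t u τ' → φ (τ • v) = φ (τ' • v) := by
    intro v u τ τ' hu h h'
    obtain ⟨κ, h1, h2⟩ := H.exists_smul_eq_of_isGeneric h h'
    have h3 := hu (τ'⁻¹ * (κ * τ)) fun a ha => by rw [mul_smul, h2 a ha, inv_smul_smul]
    rw [mul_smul, inv_smul_eq_iff, mul_smul] at h3
    rw [← h3, hφ.dual_apply h1]
  choose S hS using hfs
  choose T hT using fun u => H.exists_isGeneric D t u
  have key' : ∀ (v : V) (u : Finset 𝔸) (τ : Γ), Supports Γ u v → IsGeneric R s D t u τ →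
      φ (T (S v) • v) = φ (τ • v) := by
    intro v u τ hu h
    rw [key v (S v) _ (T (S v ∪ u)) (hS v) (hT _) ((hT _).mono Finset.subset_union_left),
      key v u _ τ hu ((hT _).mono Finset.subset_union_right) h]
  refine ⟨⟨⟨fun v => φ (T (S v) • v), fun v w => ?_⟩, fun c v => ?_⟩, ?_, key'⟩
  · rw [key' v (S v ∪ S w) (T _) ((hS v).mono Finset.subset_union_left) (hT _),
      key' w (S v ∪ S w) (T _) ((hS w).mono Finset.subset_union_right) (hT _),
      key' (v + w) (S v ∪ S w) (T _) (fun π hπ => ?_) (hT _), smul_add, map_add]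
    rw [smul_add, hS v π fun a ha => hπ a (Finset.mem_union_left _ ha),
      hS w π fun a ha => hπ a (Finset.mem_union_right _ ha)]
  · change φ _ = c • φ _
    rw [key' (c • v) (S v) (T _) (fun π hπ => by rw [smul_comm, hS v π hπ]) (hT _), smul_comm,
      map_smul]
  · rw [supports_dual_iff]
    intro π hπ v
    have h := hT (π • S v)
    change φ _ = φ _
    rw [key' (π • v) _ _ ((hS v).smul π) h, key' v (S v) (T (π • S v) * π) (hS v), mul_smul]
    refine ⟨fun d hd => by rw [mul_smul, hπ d hd, h.1 d hd], fun y hy x hx => ?_⟩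
    rw [mul_smul]
    exact h.2 _ (Finset.smul_mem_smul_finset hy) x hx

/-- Conjugating a generic move for `D` by `π` gives one for `π • D`, because `π` preserves `t`. -/
theorem isGenericPart_smul (H : Homogeneous Γ R s)
    (hfs : ∀ v : V, ∃ u : Finset 𝔸, Supports Γ u v)
    {D t : Finset 𝔸} {φ ψ ψ' : Module.Dual F V}
    (h : IsGenericPart Γ R s D t φ ψ) {π : Γ} (hφ : π • φ = φ) (ht : π • t = t)
    (h' : IsGenericPart Γ R s (π • D) t φ ψ') : π • ψ = ψ' := by
  ext v
  obtain ⟨u, hu⟩ := hfs v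
  obtain ⟨τ, hτ⟩ := H.exists_isGeneric D t (π⁻¹ • u)
  rw [dual_smul_apply, h _ _ τ (hu.smul π⁻¹) hτ, h' v u (π * τ * π⁻¹) hu]
  · conv_rhs => rw [← hφ, dual_smul_apply]
    simp only [mul_smul, inv_smul_smul]
  · refine ⟨fun d hd => ?_, fun y hy x hx hR => ?_⟩
    · obtain ⟨e, he, rfl⟩ := Finset.mem_smul_finset.1 hd
      rw [mul_smul, mul_smul, inv_smul_smul, hτ.1 e he]
    · rw [← ht] at hx
      obtain ⟨z, hz, rfl⟩ := Finset.mem_smul_finset.1 hx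
      rw [mul_smul, mul_smul] at hR ⊢
      rw [H.smul_rel] at hR
      obtain ⟨d, hd, h1, h2⟩ := hτ.2 _ (Finset.smul_mem_smul_finset hy) z hz hR
      refine ⟨π • d, ?_, (H.smul_rel _ _ _).2 h1, (H.smul_rel _ _ _).2 h2⟩
      rcases Finset.mem_union.1 hd with hd | hd
      · exact Finset.mem_union_left _ (Finset.smul_mem_smul_finset hd)
      · rw [H.smul_const π d hd]
        exact Finset.mem_union_right _ hd

end Homogeneous

end Dual

/-! ### Decomposing functionals into functionals with small supports -/

section Decomposition

variable (Γ 𝔸 F V : Type*) [Group Γ] [MulAction Γ 𝔸] [Field F] [AddCommGroup V]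
  [Module F V] [DistribMulAction Γ V] [SMulCommClass Γ F V]

/-- Every finitely supported functional is, in a canonical way, a sum of functionals with supports
of size at most `k`. -/
def HasDecomposition [DecidableEq 𝔸] (k : ℕ) : Prop :=
  ∀ φ : Module.Dual F V, (∃ t : Finset 𝔸, Supports Γ t φ) →
    ∃ (t : Finset 𝔸) (ψ : Finset 𝔸 → Module.Dual F V), (∀ D, Supports Γ D (ψ D)) ∧
      φ = ∑ D ∈ t.powerset with D.card ≤ k, ψ D ∧
      ∀ π : Γ, π • φ = φ → π • t = t ∧ ∀ D ⊆ t, π • ψ D = ψ (π • D)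

variable {Γ 𝔸 F V}

/-- The summands are the Möbius transform of `D ↦ g D`. They add up to `g t = φ`, and those with
more than `k` atoms vanish because a vector with at most `k` atoms misses an atom of `D`. -/
theorem hasDecomposition_of_eq [DecidableEq 𝔸] {s : Finset 𝔸}
    (H : Homogeneous Γ (fun x y : 𝔸 => x = y) s)
    (hfs : ∀ v : V, ∃ u : Finset 𝔸, Supports Γ u v) {k : ℕ}
    (hk : Submodule.span F {v : V | ∃ u : Finset 𝔸, u.card ≤ k ∧ Supports Γ u v} = ⊤) :
    HasDecomposition Γ 𝔸 F V k := by
  intro φ hφ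
  obtain ⟨t, ht, htπ⟩ := H.exists_least_support hφ
  choose g hgs hg using fun D => H.exists_isGenericPart hfs ht D
  have hφg : g t = φ := by
    ext v
    obtain ⟨u, hu⟩ := hfs v
    obtain ⟨τ, hτ⟩ := H.exists_isGeneric t t u
    rw [hg t v u τ hu hτ, ht.dual_apply hτ.1]
  refine ⟨t, fun D => ∑ J ∈ D.powerset, (-1 : F) ^ J.card • g (D \ J), fun D => ?_, ?_,
    fun π hπ => ⟨htπ π hπ, fun D _ => ?_⟩⟩
  · exact (supportedDual Γ F V D).sum_mem fun J _ => Submodule.smul_mem _ _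
      (supportedDual_mono Finset.sdiff_subset (hgs (D \ J)))
  · rw [Finset.sum_filter_of_ne]
    · have h1 : ∀ D ∈ t.powerset, ∑ J ∈ D.powerset, (-1 : F) ^ J.card • g (D \ J) =
          ∑ E ∈ D.powerset, (-1 : F) ^ (D \ E).card • g E := by
        intro D _
        refine Finset.sum_bij' (fun J _ => D \ J) (fun E _ => D \ E) ?_ ?_ ?_ ?_ ?_
        · intro J _; simp
        · intro J _; simp
        · intro J hJ; exact Finset.sdiff_sdiff_eq_self (Finset.mem_powerset.1 hJ)
        · intro J hJ; exact Finset.sdiff_sdiff_eq_self (Finset.mem_powerset.1 hJ)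
        · intro J hJ; rw [Finset.sdiff_sdiff_eq_self (Finset.mem_powerset.1 hJ)]
      -- After exchanging the sums, the coefficient of `g E` is an alternating sum over the subsets
      -- of `t \ E`, which is zero unless `E = t`.
      rw [Finset.sum_congr rfl h1, Finset.sum_comm' (t' := t.powerset)
        (s' := fun E => t.powerset.filter (E ⊆ ·)) (by
          intro D E
          simp only [Finset.mem_powerset, Finset.mem_filter]
          exact ⟨fun h => ⟨⟨h.1, h.2⟩, h.2.trans h.1⟩, fun h => h.1⟩)]
      rw [Finset.sum_eq_single t]
      · rw [Finset.sum_eq_single t]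
        · simp [hφg]
        · intro D hD hDt
          simp only [Finset.mem_filter, Finset.mem_powerset] at hD
          exact absurd (hD.1.antisymm hD.2) hDt
        · simp
      · intro E hE hEt
        rw [← Finset.sum_smul]
        have h2 : ∑ D ∈ t.powerset with E ⊆ D, (-1 : F) ^ (D \ E).card =
            ∑ J ∈ (t \ E).powerset, (-1 : F) ^ J.card := by
          refine Finset.sum_bij' (fun D _ => D \ E) (fun J _ => J ∪ E) ?_ ?_ ?_ ?_ ?_
          · intro D hD
            simp only [Finset.mem_filter, Finset.mem_powerset] at hD ⊢
            exact Finset.sdiff_subset_sdiff hD.1 le_rfl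
          · intro J hJ
            simp only [Finset.mem_filter, Finset.mem_powerset] at hJ hE ⊢
            exact ⟨Finset.union_subset (hJ.trans Finset.sdiff_subset) hE,
              Finset.subset_union_right⟩
          · intro D hD
            simp only [Finset.mem_filter, Finset.mem_powerset] at hD ⊢
            exact Finset.sdiff_union_of_subset hD.2
          · intro J hJ
            have : Disjoint J E := Finset.disjoint_of_subset_left (Finset.mem_powerset.1 hJ)
              Finset.sdiff_disjoint
            rw [Finset.union_sdiff_right, Finset.sdiff_eq_self_of_disjoint this]
          · intro D _; rfl
        have h3 : ∑ J ∈ (t \ E).powerset, (-1 : ℤ) ^ J.card = 0 :=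
          Finset.sum_powerset_neg_one_pow_card_of_nonempty (by
            rw [Finset.sdiff_nonempty]
            exact fun h => hEt ((Finset.mem_powerset.1 hE).antisymm h))
        have h4 := congrArg (Int.cast : ℤ → F) h3
        push_cast at h4
        rw [h2, h4, zero_smul]
      · simp
    · intro D _ hne
      by_contra hD
      refine hne (H.sum_isGenericPart_eq_zero hk (fun u hu => ?_) hg)
      obtain ⟨x, hxD, hxu⟩ := Finset.exists_mem_notMem_of_card_lt_card
        (lt_of_le_of_lt hu (not_le.1 hD))
      exact ⟨x, hxD, fun y hy hyx => absurd (hyx ▸ hy) hxu⟩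
  · have h1 : π • ∑ J ∈ D.powerset, (-1 : F) ^ J.card • g (D \ J) =
        ∑ J ∈ D.powerset, (-1 : F) ^ J.card • π • g (D \ J) := by
      ext v
      simp only [dual_smul_apply, LinearMap.sum_apply, LinearMap.smul_apply]
    rw [h1]
    refine Finset.sum_bij' (fun J _ => π • J) (fun J _ => π⁻¹ • J) ?_ ?_ ?_ ?_ ?_
    · intro J hJ
      exact Finset.mem_powerset.2 (Finset.smul_finset_subset_smul_finset (Finset.mem_powerset.1 hJ))
    · intro J hJ
      rw [Finset.mem_powerset] at hJ ⊢
      rwa [Finset.smul_finset_subset_iff, inv_inv]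
    · intro J _; exact inv_smul_smul _ _
    · intro J _; exact smul_inv_smul _ _
    · intro J _
      rw [Finset.card_smul_finset, ← Finset.smul_finset_sdiff,
        H.isGenericPart_smul hfs (hg _) hπ (htπ π hπ) (hg (π • (D \ J)))]

/-- A finite chain has no order automorphism besides the identity. -/
theorem smul_eq_of_smul_finset_eq [LinearOrder 𝔸]
    (hR : ∀ (π : Γ) (x y : 𝔸), π • x ≤ π • y ↔ x ≤ y) {t : Finset 𝔸} {π : Γ} (h : π • t = t) :
    ∀ x ∈ t, π • x = x := by
  let e : t ≃o t :=
    { toFun := fun x => ⟨π • x, by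
        have := Finset.smul_mem_smul_finset (a := π) x.2
        rwa [h] at this⟩
      invFun := fun x => ⟨π⁻¹ • x, by
        have := Finset.smul_mem_smul_finset (a := π⁻¹) x.2
        rwa [inv_smul_eq_iff.2 h.symm] at this⟩
      left_inv := fun x => Subtype.ext (inv_smul_smul _ _)
      right_inv := fun x => Subtype.ext (smul_inv_smul _ _)
      map_rel_iff' := hR π _ _ }
  intro x hx
  have : e = OrderIso.refl t := Subsingleton.elim _ _
  exact congrArg Subtype.val (congrArg (fun f : t ≃o t => f ⟨x, hx⟩) this)

/-- If `t` is large, a vanishing alternating sum expresses `φ = g t` through generic parts supported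
by proper subsets of `t`, and induction applies. -/
theorem supportedDual_le_iSup_of_le [LinearOrder 𝔸] {s : Finset 𝔸}
    (H : Homogeneous Γ (fun x y : 𝔸 => x ≤ y) s)
    (hfs : ∀ v : V, ∃ u : Finset 𝔸, Supports Γ u v) {k : ℕ}
    (hk : Submodule.span F {v : V | ∃ u : Finset 𝔸, u.card ≤ k ∧ Supports Γ u v} = ⊤)
    (t : Finset 𝔸) : supportedDual Γ F V t ≤
      ⨆ D ∈ {D ∈ t.powerset | D.card ≤ 2 * k + 1}, supportedDual Γ F V D := by
  induction t using Finset.strongInduction with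
  | H t ih =>
  by_cases htk : t.card ≤ 2 * k + 1
  · exact le_iSup₂_of_le t (by simp [htk]) le_rfl
  intro φ hφ
  choose g hgs hg using fun D => H.exists_isGenericPart hfs hφ D
  have hφg : g t = φ := by
    ext v
    obtain ⟨u, hu⟩ := hfs v
    obtain ⟨τ, hτ⟩ := H.exists_isGeneric t t u
    rw [hg t v u τ hu hτ, Supports.dual_apply hφ hτ.1]
  let e : Fin t.card ↪o 𝔸 := t.orderEmbOfFin rfl
  have he : ∀ i, e i ∈ t := Finset.orderEmbOfFin_mem t rfl
  -- Every second atom of `t` is freed, so that between any two freed atoms one of `t` stays fixed.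
  let f : Fin (k + 1) → 𝔸 := fun i => e ⟨2 * i, by omega⟩
  have hf : Function.Injective f := fun i j hij => by
    have := e.injective hij
    simp only [Fin.mk.injEq] at this
    omega
  let I : Finset 𝔸 := Finset.univ.image f
  have hI : ∀ u : Finset 𝔸, u.card ≤ k → ∃ x ∈ I, ∀ y ∈ u, y ≤ x →
      ∃ d ∈ (t \ I) ∪ s, y ≤ d ∧ d ≤ x := by
    intro u hu
    by_contra! hcon
    -- Otherwise each of the `k + 1` freed atoms has an unseparated atom of `u` below it. Two of
    -- them share it, yet the kept atom right after the smaller one separates it from the larger.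
    choose Y hY using fun i => hcon (f i) (Finset.mem_image_of_mem _ (Finset.mem_univ i))
    obtain ⟨i, -, j, -, hij, hYij⟩ := Finset.exists_ne_map_eq_of_card_lt_of_maps_to
      (s := (Finset.univ : Finset (Fin (k + 1)))) (t := u) (f := Y) (by simp; omega)
      (fun i _ => (hY i).1)
    wlog hlt : i < j generalizing i j
    · exact this j i hij.symm hYij.symm (lt_of_le_of_ne (not_lt.1 hlt) hij.symm)
    have hmem : e ⟨2 * i + 1, by omega⟩ ∈ (t \ I) ∪ s := by
      refine Finset.mem_union_left _ (Finset.mem_sdiff.2 ⟨he _, fun h => ?_⟩)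
      obtain ⟨l, -, hl⟩ := Finset.mem_image.1 h
      have := e.injective hl
      simp only [Fin.mk.injEq] at this
      omega
    have h1 : f i ≤ e ⟨2 * i + 1, by omega⟩ := e.monotone (by simp [Fin.le_def])
    have h2 : e ⟨2 * i + 1, by omega⟩ ≤ f j := e.monotone (by
      simp only [Fin.le_def]
      have : (i : ℕ) < j := hlt
      omega)
    exact absurd h2 (not_le.2 ((hY j).2.2 _ hmem (hYij ▸ (hY i).2.1.trans h1)))
  have hsum := H.sum_isGenericPart_eq_zero hk (E := t) hI hg
  rw [← Finset.add_sum_erase _ _ (Finset.empty_mem_powerset I), Finset.sdiff_empty, hφg,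
    Finset.card_empty, pow_zero, one_smul, add_eq_zero_iff_eq_neg] at hsum
  rw [hsum]
  refine Submodule.neg_mem _ (Submodule.sum_mem _ fun J hJ => Submodule.smul_mem _ _ ?_)
  have hIt : I ⊆ t := by
    intro x hx
    obtain ⟨i, -, rfl⟩ := Finset.mem_image.1 hx
    exact he _
  have hlt : t \ J ⊂ t := by
    obtain ⟨hJ0, hJI⟩ := Finset.mem_erase.1 hJ
    exact Finset.sdiff_ssubset ((Finset.mem_powerset.1 hJI).trans hIt)
      (Finset.nonempty_iff_ne_empty.2 hJ0)
  refine (ih _ hlt).trans (iSup₂_le fun D hD => le_iSup₂_of_le D ?_ le_rfl) (hgs (t \ J))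
  simp only [Finset.mem_filter, Finset.mem_powerset] at hD ⊢
  exact ⟨hD.1.trans Finset.sdiff_subset, hD.2⟩

theorem hasDecomposition_of_le [LinearOrder 𝔸] {s : Finset 𝔸}
    (H : Homogeneous Γ (fun x y : 𝔸 => x ≤ y) s)
    (hfs : ∀ v : V, ∃ u : Finset 𝔸, Supports Γ u v) {k : ℕ}
    (hk : Submodule.span F {v : V | ∃ u : Finset 𝔸, u.card ≤ k ∧ Supports Γ u v} = ⊤) :
    HasDecomposition Γ 𝔸 F V (2 * k + 1) := by
  intro φ hφ
  obtain ⟨t, ht, htπ⟩ := H.exists_least_support hφ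
  have h := supportedDual_le_iSup_of_le H hfs hk t ht
  rw [Submodule.mem_iSup_finset_iff_exists_sum] at h
  obtain ⟨μ, hμ⟩ := h
  refine ⟨t, fun D => μ D, fun D => (μ D).2, hμ.symm, fun π hπ => ⟨htπ π hπ, fun D hD => ?_⟩⟩
  have h1 := smul_eq_of_smul_finset_eq H.smul_rel (htπ π hπ)
  have h2 : π • D = D := by
    refine Finset.eq_of_subset_of_card_le (fun x hx => ?_) (by simp)
    obtain ⟨y, hy, rfl⟩ := Finset.mem_smul_finset.1 hx
    rwa [h1 y (hD hy)]
  rw [h2]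
  exact (μ D).2 π fun d hd => h1 d (hD hd)

end Decomposition

/-! ### Equivariant lifting of functionals -/

/-- Choose at one representative per orbit and transport; invariance under the stabilizer makes this
unambiguous. -/
theorem exists_equivariant_choice {Γ X Y : Type*} [Group Γ] [MulAction Γ X] [MulAction Γ Y]
    (r : X → Y → Prop) (hr : ∀ (π : Γ) x y, r x y → r (π • x) (π • y))
    (h : ∀ x, ∃ y, r x y ∧ ∀ π : Γ, π • x = x → π • y = y) :
    ∃ f : X → Y, (∀ x, r x (f x)) ∧ ∀ (π : Γ) x, f (π • x) = π • f x := by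
  choose y hy hyπ using h
  let rep : X → X := fun x => (Quotient.mk (MulAction.orbitRel Γ X) x).out
  have hrep : ∀ x, ∃ g : Γ, g • rep x = x := fun x => by
    have : MulAction.orbitRel Γ X x (rep x) :=
      (MulAction.orbitRel Γ X).symm
        (Quotient.exact (Quotient.out_eq (Quotient.mk (MulAction.orbitRel Γ X) x)))
    exact this
  choose g hg using hrep
  refine ⟨fun x => g x • y (rep x), fun x => ?_, fun π x => ?_⟩
  · have := hr (g x) _ _ (hy (rep x))
    rwa [hg] at this
  · have h1 : rep (π • x) = rep x := congrArg Quotient.out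
      (Quotient.sound (s := MulAction.orbitRel Γ X) (MulAction.mem_orbit x π))
    dsimp only
    rw [h1, eq_comm, ← inv_smul_eq_iff, ← mul_smul, ← mul_smul]
    refine (hyπ _ _ ?_)
    rw [mul_smul, mul_smul, hg, inv_smul_eq_iff, ← h1, hg]

section Lift

variable {Γ 𝔸 F V : Type*} [Group Γ] [MulAction Γ 𝔸] [Field F] [AddCommGroup V]
  [Module F V] [DistribMulAction Γ V] [SMulCommClass Γ F V]

theorem linearCombination_mapDomain_smul (π : Γ) (x : Module.Dual F V →₀ F) :
    Finsupp.linearCombination F id (x.mapDomain (π • ·)) =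
      π • Finsupp.linearCombination F id x := by
  rw [Finsupp.linearCombination_mapDomain]
  ext v
  simp only [Finsupp.linearCombination_apply, Finsupp.sum, LinearMap.sum_apply, dual_smul_apply,
    LinearMap.smul_apply, Function.comp, id]

variable [DecidableEq 𝔸] {R : 𝔸 → 𝔸 → Prop} {s : Finset 𝔸}

/-- Such a functional is determined by its values on representatives of the spanning vectors modulo
automorphisms fixing `D`, and finitely many representatives suffice. -/
theorem Homogeneous.finite_supportedDual (H : Homogeneous Γ R s)
    (hfs : ∀ v : V, ∃ u : Finset 𝔸, Supports Γ u v) {T : Set V} (hT : T.Finite)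
    (hspan : Submodule.span F (⋃ v ∈ T, MulAction.orbit Γ v) = ⊤) (D : Finset 𝔸) :
    Module.Finite F (supportedDual Γ F V D) := by
  choose S hS using hfs
  choose B hBfin _ hB using fun v => H.exists_finite_orbit_reps (hS v) D _ subset_rfl
  have hBT : (⋃ v ∈ T, B v).Finite := hT.biUnion fun v _ => hBfin v
  have := hBT.to_subtype
  let Φ : supportedDual Γ F V D →ₗ[F] (↥(⋃ v ∈ T, B v) → F) :=
    { toFun := fun φ b => φ.1 b
      map_add' := fun _ _ => rfl
      map_smul' := fun _ _ => rfl }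
  refine Module.Finite.of_injective Φ fun φ₁ φ₂ hφ => sub_eq_zero.1 ?_
  obtain ⟨φ, hφ'⟩ : ∃ φ, φ = φ₁ - φ₂ := ⟨_, rfl⟩
  rw [← hφ']
  refine Subtype.ext (?_ : φ.1 = 0)
  rw [← LinearMap.ker_eq_top, eq_top_iff, ← hspan, Submodule.span_le]
  intro w hw
  obtain ⟨v, hv, hw⟩ := Set.mem_iUnion₂.1 hw
  obtain ⟨y, hy, σ, hσ, rfl⟩ := hB v w hw
  rw [SetLike.mem_coe, LinearMap.mem_ker, Supports.dual_apply φ.2 hσ]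
  rw [hφ']
  exact sub_eq_zero.2 (congrFun hφ ⟨y, Set.mem_iUnion₂.2 ⟨v, hv, hy⟩⟩)

/-- The coordinates of `ψ` must be invariant under its stabilizer, and averaging is unavailable in
positive characteristic. Instead each of the finitely many sets `h` of maps on `D` gets its own
generators of the subspace `W h` of invariant functionals; `ψ` uses the `h` induced by its own
stabilizer. -/
theorem exists_finite_generators (D : Finset 𝔸) [Module.Finite F (supportedDual Γ F V D)] :
    ∃ Ψ : Set (Module.Dual F V), Ψ.Finite ∧ (∀ ψ ∈ Ψ, Supports Γ D ψ) ∧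
      ∀ ψ : Module.Dual F V, Supports Γ D ψ → ∃ x : Module.Dual F V →₀ F,
        ↑x.support ⊆ Ψ ∧ Finsupp.linearCombination F id x = ψ ∧
        ∀ p ∈ x.support, ∀ π : Γ, π • D = D → π • ψ = ψ → π • p = p := by
  let W : Set (D → D) → Submodule F (Module.Dual F V) := fun h =>
    supportedDual Γ F V D ⊓ fixedDual F V {π : Γ | ∃ f ∈ h, ∀ a : D, π • (a : 𝔸) = f a}
  have hW : ∀ h, (W h).FG := fun h => Module.Finite.iff_fg.1
    (Submodule.finiteDimensional_of_le (S₂ := supportedDual Γ F V D) inf_le_left)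
  choose S hS using hW
  have hSW : ∀ h, ∀ p ∈ S h, p ∈ W h := fun h p hp => hS h ▸ Submodule.subset_span hp
  refine ⟨⋃ h, ↑(S h), Set.finite_iUnion fun h => (S h).finite_toSet, ?_, ?_⟩
  · intro p hp
    obtain ⟨h, hp⟩ := Set.mem_iUnion.1 hp
    exact (hSW h p hp).1
  · intro ψ hψ
    let h : Set (D → D) := {f | ∃ π : Γ, π • ψ = ψ ∧ ∀ a : D, π • (a : 𝔸) = f a}
    have hψW : ψ ∈ W h := by
      refine ⟨hψ, ?_⟩
      rintro π ⟨f, ⟨ρ, hρ, hρf⟩, hπf⟩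
      have := hψ (ρ⁻¹ * π) fun d hd => by
        rw [mul_smul, inv_smul_eq_iff, hρf ⟨d, hd⟩, hπf ⟨d, hd⟩]
      rwa [mul_smul, inv_smul_eq_iff, hρ] at this
    rw [← hS h, ← Set.image_id (S h : Set (Module.Dual F V)),
      Finsupp.mem_span_image_iff_linearCombination] at hψW
    obtain ⟨x, hx, hxψ⟩ := hψW
    have hx' : ∀ p ∈ x.support, p ∈ S h := fun p hp => (Finsupp.mem_supported F x).1 hx hp
    refine ⟨x, fun p hp => Set.mem_iUnion.2 ⟨h, hx' p hp⟩, hxψ, fun p hp π hπD hπ => ?_⟩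
    refine (hSW h p (hx' p hp)).2 π
      ⟨fun a => ⟨π • (a : 𝔸), ?_⟩, ⟨π, hπ, fun _ => rfl⟩, fun _ => rfl⟩
    have := Finset.smul_mem_smul_finset (a := π) a.2
    rwa [hπD] at this

theorem Homogeneous.exists_finite_finsets (H : Homogeneous Γ R s) (k : ℕ) :
    ∃ 𝓓 : Set (Finset 𝔸), 𝓓.Finite ∧
      ∀ D : Finset 𝔸, D.card ≤ k → ∃ D₀ ∈ 𝓓, ∃ σ : Γ, σ • D₀ = D := by
  choose T hT _ h using fun n : ℕ =>
    H.exists_finite_tuples (ι := Fin n) ∅ (Set.univ : Set (Fin n → 𝔸))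
  refine ⟨⋃ n ∈ Set.Iic k, (fun x => Finset.univ.image x) '' T n,
    (Set.finite_Iic k).biUnion fun n _ => (hT n).image _, fun D hD => ?_⟩
  obtain ⟨y, hy, σ, -, hσ⟩ := h D.card (fun i => D.equivFin.symm i) trivial
  refine ⟨_, Set.mem_iUnion₂.2 ⟨D.card, hD, Set.mem_image_of_mem _ hy⟩, σ, ?_⟩
  ext a
  simp only [Finset.mem_smul_finset, Finset.mem_image, Finset.mem_univ, true_and]
  constructor
  · rintro ⟨_, ⟨i, rfl⟩, rfl⟩
    rw [hσ]
    exact (D.equivFin.symm i).2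
  · intro ha
    refine ⟨_, ⟨D.equivFin ⟨a, ha⟩, rfl⟩, ?_⟩
    rw [hσ, Equiv.symm_apply_apply]

/-- The linear combinations of some orbit-finite set of functionals cover all finitely supported
functionals, equivariantly. -/
theorem Homogeneous.exists_equivariant_lift (H : Homogeneous Γ R s)
    (hfs : ∀ v : V, ∃ u : Finset 𝔸, Supports Γ u v) {T : Set V} (hT : T.Finite)
    (hspan : Submodule.span F (⋃ v ∈ T, MulAction.orbit Γ v) = ⊤) {k : ℕ}
    (hdec : HasDecomposition Γ 𝔸 F V k) :
    ∃ Ψ : Set (Module.Dual F V), Ψ.Finite ∧ (∀ ψ ∈ Ψ, ∃ D : Finset 𝔸, Supports Γ D ψ) ∧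
      ∃ l : Module.Dual F V → (Module.Dual F V →₀ F),
        (∀ φ, (∃ t : Finset 𝔸, Supports Γ t φ) →
          ↑(l φ).support ⊆ (⋃ ψ ∈ Ψ, MulAction.orbit Γ ψ) ∧
          Finsupp.linearCombination F id (l φ) = φ) ∧
        ∀ (π : Γ) φ, l (π • φ) = (l φ).mapDomain (π • ·) := by
  classical
  let _ : MulAction Γ (Module.Dual F V →₀ F) := Finsupp.comapMulAction
  have hact : ∀ (π : Γ) (x : Module.Dual F V →₀ F), π • x = x.mapDomain (π • ·) :=
    fun _ _ => rfl
  have hactz : ∀ (π : Γ), π • (0 : Module.Dual F V →₀ F) = 0 := fun _ => Finsupp.mapDomain_zero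
  obtain ⟨𝓓, h𝓓, h𝓓D⟩ := H.exists_finite_finsets k
  have := H.finite_supportedDual hfs hT hspan
  choose Ψ hΨ hΨs hΨx using fun D : Finset 𝔸 => exists_finite_generators (Γ := Γ) (F := F)
    (V := V) D
  have hP : ∀ (π : Γ), ∀ p ∈ (⋃ ψ ∈ ⋃ D ∈ 𝓓, Ψ D, MulAction.orbit Γ ψ),
      π • p ∈ (⋃ ψ ∈ ⋃ D ∈ 𝓓, Ψ D, MulAction.orbit Γ ψ) := by
    intro π p hp
    obtain ⟨ψ, hψ, hp⟩ := Set.mem_iUnion₂.1 hp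
    exact Set.mem_iUnion₂.2 ⟨ψ, hψ, MulAction.mem_orbit_of_mem_orbit π hp⟩
  have hPx : ∀ (π : Γ) (x : Module.Dual F V →₀ F),
      ↑x.support ⊆ (⋃ ψ ∈ ⋃ D ∈ 𝓓, Ψ D, MulAction.orbit Γ ψ) →
      ↑(π • x).support ⊆ (⋃ ψ ∈ ⋃ D ∈ 𝓓, Ψ D, MulAction.orbit Γ ψ) := by
    intro π x hx p hp
    obtain ⟨q, hq, rfl⟩ := Finset.mem_image.1 (Finsupp.mapDomain_support hp)
    exact hP π q (hx hq)
  refine ⟨⋃ D ∈ 𝓓, Ψ D, h𝓓.biUnion fun D _ => hΨ D, fun ψ hψ => ?_, ?_⟩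
  · obtain ⟨D, _, hψ⟩ := Set.mem_iUnion₂.1 hψ
    exact ⟨D, hΨs D ψ hψ⟩
  have hΨP : ∀ D ∈ 𝓓, Ψ D ⊆ (⋃ ψ ∈ ⋃ D ∈ 𝓓, Ψ D, MulAction.orbit Γ ψ) := fun D hD ψ hψ =>
    Set.mem_iUnion₂.2 ⟨ψ, Set.mem_iUnion₂.2 ⟨D, hD, hψ⟩, MulAction.mem_orbit_self ψ⟩
  generalize (⋃ ψ ∈ ⋃ D ∈ 𝓓, Ψ D, MulAction.orbit Γ ψ) = P at *
  -- Small functionals are lifted together with a chosen support, so that a stabilizer preserves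
  -- both; each pair is carried to one of the finitely many sets in `𝓓`.
  obtain ⟨f, hf, hfπ⟩ := exists_equivariant_choice (Γ := Γ) (X := Finset 𝔸 × Module.Dual F V)
    (Y := Module.Dual F V →₀ F)
    (fun X y => X.1.card ≤ k → Supports Γ X.1 X.2 →
      ↑y.support ⊆ P ∧ Finsupp.linearCombination F id y = X.2)
    (by
      rintro π ⟨D, ψ⟩ y h hk hD
      have := h (by simpa using hk) (by
        have := hD.smul π⁻¹
        simpa using this)
      exact ⟨hPx π y this.1, by rw [hact, linearCombination_mapDomain_smul, this.2]; rfl⟩)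
    (by
      rintro ⟨D, ψ⟩
      by_cases hD : D.card ≤ k ∧ Supports Γ D ψ
      · obtain ⟨D₀, hD₀, σ, rfl⟩ := h𝓓D D hD.1
        obtain ⟨x, hx, hxψ, hxπ⟩ := hΨx D₀ (σ⁻¹ • ψ) (by simpa using hD.2.smul σ⁻¹)
        refine ⟨σ • x, fun _ _ => ⟨hPx σ x (hx.trans (hΨP D₀ hD₀)), ?_⟩, fun π hπ => ?_⟩
        · rw [hact, linearCombination_mapDomain_smul, hxψ, smul_inv_smul]
        · obtain ⟨h1, h2⟩ := Prod.ext_iff.1 hπ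
          change π • σ • D₀ = σ • D₀ at h1
          change π • ψ = ψ at h2
          rw [← inv_smul_eq_iff (g := σ), ← mul_smul, ← mul_smul, hact]
          conv_rhs => rw [← Finsupp.mapDomain_id (v := x)]
          refine Finsupp.mapDomain_congr fun p hp => hxπ p hp _ ?_ ?_
          · rw [mul_smul, mul_smul, h1, inv_smul_smul]
          · rw [mul_smul, mul_smul, smul_inv_smul, h2]
      · exact ⟨0, fun h1 h2 => absurd ⟨h1, h2⟩ hD, fun π _ => hactz π⟩)
  -- A general functional gets the sum of the lifts of its summands; its stabilizer only permutes
  -- them.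
  obtain ⟨l, hl, hlπ⟩ := exists_equivariant_choice (Γ := Γ) (X := Module.Dual F V)
    (Y := Module.Dual F V →₀ F)
    (fun φ y => (∃ t : Finset 𝔸, Supports Γ t φ) →
      ↑y.support ⊆ P ∧ Finsupp.linearCombination F id y = φ)
    (by
      rintro π φ y h ⟨t, ht⟩
      have := h ⟨π⁻¹ • t, by simpa using ht.smul π⁻¹⟩
      exact ⟨hPx π y this.1, by rw [hact, linearCombination_mapDomain_smul, this.2]⟩)
    (by
      intro φ
      by_cases hφ : ∃ t : Finset 𝔸, Supports Γ t φ
      · obtain ⟨t, ψ, hψ, hsum, hπ⟩ := hdec φ hφ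
        have hmem : ∀ D ∈ {D ∈ t.powerset | D.card ≤ k},
          ↑(f (D, ψ D)).support ⊆ P ∧ Finsupp.linearCombination F id (f (D, ψ D)) = ψ D :=
          fun D hD => hf (D, ψ D) (Finset.mem_filter.1 hD).2 (hψ D)
        refine ⟨∑ D ∈ t.powerset with D.card ≤ k, f (D, ψ D), fun _ => ⟨?_, ?_⟩, ?_⟩
        · intro p hp
          obtain ⟨D, hD, hp⟩ := Finset.mem_biUnion.1 (Finsupp.support_finsetSum hp)
          exact (hmem D hD).1 hp
        · rw [map_sum, hsum]
          exact Finset.sum_congr rfl fun D hD => (hmem D hD).2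
        · intro π hπφ
          obtain ⟨h1, h2⟩ := hπ π hπφ
          rw [hact, Finsupp.mapDomain_finsetSum]
          refine Finset.sum_bij' (fun D _ => π • D) (fun D _ => π⁻¹ • D) ?_ ?_ ?_ ?_ ?_
          · intro D hD
            simp only [Finset.mem_filter, Finset.mem_powerset, Finset.card_smul_finset] at hD ⊢
            rw [← h1]
            exact ⟨Finset.smul_finset_subset_smul_finset hD.1, hD.2⟩
          · intro D hD
            simp only [Finset.mem_filter, Finset.mem_powerset, Finset.card_smul_finset] at hD ⊢
            rw [Finset.smul_finset_subset_iff, inv_inv, h1]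
            exact hD
          · intro D _; exact inv_smul_smul _ _
          · intro D _; exact smul_inv_smul _ _
          · intro D hD
            rw [← hact, ← hfπ, ← h2 D (Finset.mem_powerset.1 (Finset.mem_filter.1 hD).1)]
            rfl
      · exact ⟨0, fun h => absurd h hφ, fun π _ => hactz π⟩)
  exact ⟨l, hl, hlπ⟩

end Lift

/-! ### The equality atoms and the ordered atoms -/

theorem mem_fixAtoms {G 𝔸 : Type} [Group G] [MulAction G 𝔸] {s : Finset 𝔸} {π : G} :
    π ∈ fixAtoms G 𝔸 s ↔ ∀ a ∈ s, π • a = a := by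
  simp [fixAtoms, mem_fixingSubgroup_iff]

theorem fixAtoms_anti {G 𝔸 : Type} [Group G] [MulAction G 𝔸] {s t : Finset 𝔸} (h : s ⊆ t) :
    fixAtoms G 𝔸 t ≤ fixAtoms G 𝔸 s :=
  fun _ hπ => mem_fixAtoms.2 fun a ha => mem_fixAtoms.1 hπ a (h ha)

theorem Homogeneous.fixAtoms {G 𝔸 : Type} [Group G] [MulAction G 𝔸] {R : 𝔸 → 𝔸 → Prop}
    (H : Homogeneous G R ∅) (s : Finset 𝔸) : Homogeneous (fixAtoms G 𝔸 s) R s where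
  refl := H.refl
  trans := H.trans
  antisymm := H.antisymm
  symm_or_total := H.symm_or_total
  smul_rel π := H.smul_rel π
  smul_const π := mem_fixAtoms.1 π.2
  extend D x y hs h := by
    obtain ⟨σ, h1, h2⟩ := H.extend D x y (Finset.empty_subset D) h
    exact ⟨⟨σ, mem_fixAtoms.2 fun a ha => h1 a (hs ha)⟩, h1, h2⟩
  exists_fresh := H.exists_fresh
  exists_shift := H.exists_shift

theorem homogeneous_perm_nat : Homogeneous (Equiv.Perm ℕ) (fun x y : ℕ => x = y) ∅ where
  refl _ := rfl
  trans _ _ _ := Eq.trans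
  antisymm _ _ h _ := h
  symm_or_total := Or.inl fun _ _ => Eq.symm
  smul_rel π _ _ := π.injective.eq_iff
  smul_const _ _ hx := absurd hx (Finset.notMem_empty _)
  extend D x y _ h := by
    refine ⟨Equiv.swap x y, fun d hd => ?_, Equiv.swap_apply_left x y⟩
    have := (h d hd).1
    by_cases hdx : d = x
    · have : y = x := (this.1 hdx).symm.trans hdx
      rw [this, Equiv.swap_self]
      rfl
    · exact Equiv.swap_apply_of_ne_of_ne hdx fun hdy => hdx (this.2 hdy)
  exists_fresh D t y hy := by
    obtain ⟨z, hz⟩ := Infinite.exists_notMem_finset (D ∪ t)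
    simp only [Finset.mem_union, not_or] at hz
    refine ⟨z, fun d hd => ?_, fun x hx hzx => absurd (hzx ▸ hx) hz.2⟩
    have h1 : d ≠ y := fun h => hy (h ▸ hd)
    have h2 : d ≠ z := fun h => hz.1 (h ▸ hd)
    simp [h1, h2, h1.symm, h2.symm]
  exists_shift D x y hx := by
    obtain ⟨z, hz⟩ := Infinite.exists_notMem_finset (D ∪ {x, y})
    simp only [Finset.mem_union, Finset.mem_insert, Finset.mem_singleton, not_or] at hz
    refine ⟨z, fun d hd => ?_, ?_, ?_⟩
    · have h1 : d ≠ x := fun h => hx (h ▸ hd)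
      have h2 : d ≠ z := fun h => hz.1 (h ▸ hd)
      simp [h1, h2, h1.symm, h2.symm]
    · simp [hz.2.1, hz.2.2]
    · simp [Ne.symm hz.2.1, Ne.symm hz.2.2]

/-- The pointwise maximum of two automorphisms of a linear order. -/
def orderIsoSup {α : Type*} [LinearOrder α] (f g : α ≃o α) : α ≃o α where
  toFun z := f z ⊔ g z
  invFun w := f.symm w ⊓ g.symm w
  left_inv z := by
    refine le_antisymm ?_ (le_inf ?_ ?_)
    · rw [inf_le_iff, f.symm_apply_le, g.symm_apply_le, ← le_sup_iff]
    · rw [f.le_symm_apply]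
      exact le_sup_left
    · rw [g.le_symm_apply]
      exact le_sup_right
  right_inv w := by
    refine le_antisymm (sup_le ?_ ?_) ?_
    · rw [← f.le_symm_apply]
      exact inf_le_left
    · rw [← g.le_symm_apply]
      exact inf_le_right
    · rw [le_sup_iff, ← f.symm_apply_le, ← g.symm_apply_le, ← inf_le_iff]
  map_rel_iff' {z w} := by
    refine ⟨fun h => ?_, fun h => sup_le_sup (f.monotone h) (g.monotone h)⟩
    by_contra hwz
    rw [not_le] at hwz
    exact absurd h (not_le.2 (max_lt_max (f.strictMono hwz) (g.strictMono hwz)))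

/-- The affine automorphism of `ℚ` with fixed point `c` and slope `m`. -/
def affineOrderIso (c : ℚ) {m : ℚ} (hm : 0 < m) : ℚ ≃o ℚ where
  toFun z := c + (z - c) * m
  invFun z := c + (z - c) / m
  left_inv z := by field_simp; ring
  right_inv z := by field_simp; ring
  map_rel_iff' {z w} := by simp [hm]

theorem exists_orderIso_apply_eq {a b x y : ℚ} (hax : a < x) (hxy : x < y) (hyb : y < b) :
    ∃ σ : ℚ ≃o ℚ, σ x = y ∧ ∀ d, d ≤ a ∨ b ≤ d → σ d = d := by
  have h1 : 0 < x - a := by linarith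
  have h2 : 0 < b - x := by linarith
  have h3 : 0 < (y - a) / (x - a) := by apply div_pos <;> linarith
  have h4 : 0 < (b - y) / (b - x) := by apply div_pos <;> linarith
  have h5 : 1 ≤ (y - a) / (x - a) := by rw [le_div_iff₀ h1]; linarith
  have h6 : (b - y) / (b - x) ≤ 1 := by rw [div_le_iff₀ h2]; linarith
  let e₁ := affineOrderIso a h3
  let e₂ := affineOrderIso b h4
  have he₁ : ∀ z, e₁ z = a + (z - a) * ((y - a) / (x - a)) := fun _ => rfl
  have he₂ : ∀ z, e₂ z = b + (z - b) * ((b - y) / (b - x)) := fun _ => rfl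
  -- The minimum of `e₁` and `e₂` is the inverse of the maximum of their inverses. Both send `x` to
  -- `y`; to the left of `a` the first, to the right of `b` the second lies below the identity.
  have h : ∀ z, orderIsoSup (OrderIso.refl ℚ) (orderIsoSup e₁.symm e₂.symm).symm z =
      z ⊔ (e₁ z ⊓ e₂ z) := fun _ => rfl
  refine ⟨_, (h x).trans ?_, fun d hd => (h d).trans (sup_eq_left.2 ?_)⟩
  · have e1 : e₁ x = y := by rw [he₁]; field_simp; ring
    have e2 : e₂ x = y := by rw [he₂]; field_simp; ring
    rw [e1, e2, inf_idem, sup_eq_right]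
    exact hxy.le
  · rw [inf_le_iff, he₁, he₂]
    rcases hd with hd | hd
    · left; nlinarith
    · right; nlinarith

theorem exists_orderIso_fix {D : Finset ℚ} {x y : ℚ} (hxy : x < y)
    (h : SameType (fun x y : ℚ => x ≤ y) D x y) :
    ∃ σ : ℚ ≃o ℚ, (∀ d ∈ D, σ d = d) ∧ σ x = y := by
  have hD : ∀ d ∈ D, d < x ∨ y < d := fun d hd => by
    obtain ⟨h1, h2⟩ := h d hd
    by_contra! hc
    exact absurd ((h2.1 hc.1).trans (h1.2 hc.2)) (not_le.2 hxy)
  obtain ⟨a, ha, hax⟩ := Order.exists_between_finsets {d ∈ D | d < x} {x} (by simp)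
  obtain ⟨b, hb, hyb⟩ := Order.exists_between_finsets {y} {d ∈ D | y < d} (by simp)
  obtain ⟨σ, h1, h2⟩ := exists_orderIso_apply_eq (hax x (by simp)) hxy (hb y (by simp))
  refine ⟨σ, fun d hd => h2 d ?_, h1⟩
  rcases hD d hd with hd' | hd'
  · exact Or.inl (ha d (by simp [hd, hd'])).le
  · exact Or.inr (hyb d (by simp [hd, hd'])).le

theorem homogeneous_orderIso_rat : Homogeneous (ℚ ≃o ℚ) (fun x y : ℚ => x ≤ y) ∅ where
  refl := le_refl
  trans _ _ _ := le_trans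
  antisymm _ _ := le_antisymm
  symm_or_total := Or.inr le_total
  smul_rel π _ _ := π.le_iff_le
  smul_const _ _ hx := absurd hx (Finset.notMem_empty _)
  extend D x y _ h := by
    rcases lt_trichotomy x y with hxy | rfl | hxy
    · exact exists_orderIso_fix hxy h
    · exact ⟨1, fun d _ => one_smul _ d, one_smul _ x⟩
    · obtain ⟨σ, h1, h2⟩ := exists_orderIso_fix hxy (D := D) fun d hd =>
        ⟨(h d hd).1.symm, (h d hd).2.symm⟩
      exact ⟨σ⁻¹, fun d hd => inv_smul_eq_iff.2 (h1 d hd).symm, inv_smul_eq_iff.2 h2.symm⟩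
  exists_fresh D t y hy := by
    obtain ⟨z, hz1, hz2⟩ := Order.exists_between_finsets
      (insert y {x ∈ t | ∀ n ∈ D, y < n → x < n}) {n ∈ D | y < n} (by
        intro x hx n hn
        simp only [Finset.mem_insert, Finset.mem_filter] at hx hn
        rcases hx with rfl | hx
        · exact hn.2
        · exact hx.2 n hn.1 hn.2)
    have hyz : y < z := hz1 y (Finset.mem_insert_self _ _)
    have hzn : ∀ n ∈ D, y < n → z < n := fun n hn hyn => hz2 n (by simp [hn, hyn])
    refine ⟨z, fun d hd => ⟨⟨fun h => h.trans hyz.le, fun h => ?_⟩, ⟨fun h => ?_, fun h =>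
      hyz.le.trans h⟩⟩, fun x hx hzx => ?_⟩
    · by_contra hc
      exact absurd h (not_le.2 (hzn d hd (not_le.1 hc)))
    · exact (hzn d hd (lt_of_le_of_ne h fun e => hy (e ▸ hd))).le
    · by_contra! hc
      refine absurd hzx (not_le.2 (hz1 x (Finset.mem_insert_of_mem (Finset.mem_filter.2
        ⟨hx, fun n hn hyn => hc n hn (hzn n hn hyn).le⟩))))
  exists_shift D x y hx := by
    -- The atom `z` is put next to `x`, on the side away from `y`.
    rcases le_or_gt x y with hxy | hxy
    · obtain ⟨z, hz1, hz2⟩ := Order.exists_between_finsets {d ∈ D | d < x} {x} (by simp)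
      have hzx : z < x := hz2 x (by simp)
      have hdz : ∀ d ∈ D, d < x → d < z := fun d hd hdx => hz1 d (by simp [hd, hdx])
      refine ⟨z, fun d hd => ⟨⟨fun h => ?_, fun h => h.trans hzx.le⟩, ⟨fun h => hzx.le.trans h,
        fun h => ?_⟩⟩, iff_of_true hzx.le (hzx.le.trans hxy),
        iff_of_false (not_le.2 hzx) (not_le.2 (hzx.trans_le hxy))⟩
      · exact (hdz d hd (lt_of_le_of_ne h fun e => hx (e ▸ hd))).le
      · by_contra hc
        exact absurd h (not_le.2 (hdz d hd (not_le.1 hc)))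
    · obtain ⟨z, hz1, hz2⟩ := Order.exists_between_finsets {x} {d ∈ D | x < d} (by simp)
      have hxz : x < z := hz1 x (by simp)
      have hzd : ∀ d ∈ D, x < d → z < d := fun d hd hdx => hz2 d (by simp [hd, hdx])
      refine ⟨z, fun d hd => ⟨⟨fun h => h.trans hxz.le, fun h => ?_⟩, ⟨fun h => ?_,
        fun h => hxz.le.trans h⟩⟩, iff_of_false (not_le.2 hxz) (not_le.2 (hxy.trans hxz)),
        iff_of_true hxz.le (hxy.trans hxz).le⟩
      · by_contra hc
        exact absurd h (not_le.2 (hzd d hd (not_le.1 hc)))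
      · exact (hzd d hd (lt_of_le_of_ne h fun e => hx (e ▸ hd))).le

/-! ### Weighted automata as basic automata -/

theorem IsOrbitFinite.image {G 𝔸 : Type} [Group G] [MulAction G 𝔸] {X Y : Type*} [MulAction G X]
    [MulAction G Y] {S : Set X} (hS : IsOrbitFinite G 𝔸 S) {f : X → Y}
    (hf : ∀ (g : G) x, f (g • x) = g • f x) : IsOrbitFinite G 𝔸 (f '' S) := by
  obtain ⟨⟨⟨s, hs⟩, hmem⟩, t, T, hT, rfl⟩ := hS
  refine ⟨⟨⟨s, fun π hπ => ?_⟩, ?_⟩, t, f '' T, hT.image f, ?_⟩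
  · conv_rhs => rw [← hs π hπ]
    rw [← Set.image_smul, ← Set.image_smul, Set.image_image, Set.image_image]
    simp only [hf]
  · rintro _ ⟨x, hx, rfl⟩
    obtain ⟨r, hr⟩ := hmem x hx
    exact ⟨r, fun π hπ => by rw [← hf, hr π hπ]⟩
  · rw [Set.image_iUnion₂, Set.biUnion_image]
    refine Set.iUnion₂_congr fun x _ => ?_
    ext y
    constructor
    · rintro ⟨_, ⟨g, rfl⟩, rfl⟩
      exact ⟨g, (hf _ _).symm⟩
    · rintro ⟨g, rfl⟩
      exact ⟨_, ⟨g, rfl⟩, hf _ _⟩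

/-- The free vector space over `X`, with the action induced by an action on `X`. -/
def FreeSpace (F X : Type*) [Zero F] : Type _ := X →₀ F

noncomputable instance {G F X : Type*} [Group G] [MulAction G X] [AddCommMonoid F] :
    MulAction G (FreeSpace F X) :=
  Finsupp.comapMulAction (G := G) (α := X) (M := F)

namespace WeightedAutomaton

variable {G 𝔸 : Type} [Group G] [MulAction G 𝔸] {F : Type u} [Field F] {X : Type v}
  [MulAction G X] {A : Set X} (W : WeightedAutomaton G 𝔸 F A)

theorem init_support_finite : (Function.support W.init).Finite := W.init_finite

theorem trans_support_finite (q : W.Q) (a : A) : (Function.support (W.trans q a)).Finite :=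
  W.trans_finite q a

/-- The initial weights as a vector. -/
noncomputable def initVector : W.Q →₀ F := Finsupp.ofSupportFinite W.init W.init_support_finite

/-- The transition weights from a state as a vector. -/
noncomputable def transVector (q : W.Q) (a : A) : W.Q →₀ F :=
  Finsupp.ofSupportFinite (W.trans q a) (W.trans_support_finite q a)

/-- The transition weights for a letter as a linear map. -/
noncomputable def transLinear (a : A) : (W.Q →₀ F) →ₗ[F] (W.Q →₀ F) :=
  Finsupp.linearCombination F fun q => W.transVector q a

/-- The weight of a run, without the final weight. -/
def prefixWeight {n : ℕ} (a : Fin n → A) (ρ : Fin (n + 1) → W.Q) : F :=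
  W.init (ρ 0) * ∏ i : Fin n, W.trans (ρ i.castSucc) (a i) (ρ i.succ)

theorem prefixWeight_snoc {n : ℕ} (a : Fin (n + 1) → A) (ρ : Fin (n + 1) → W.Q) (p : W.Q) :
    W.prefixWeight a (Fin.snoc ρ p : Fin (n + 1 + 1) → W.Q) =
      W.prefixWeight (fun i => a i.castSucc) ρ * W.trans (ρ (Fin.last n)) (a (Fin.last n)) p := by
  unfold prefixWeight
  rw [Fin.prod_univ_castSucc, ← mul_assoc]
  congr 2
  · refine Finset.prod_congr rfl fun i _ => ?_
    rw [Fin.snoc_castSucc (α := fun _ => W.Q), Fin.succ_castSucc,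
      Fin.snoc_castSucc (α := fun _ => W.Q)]
  · rw [Fin.snoc_castSucc (α := fun _ => W.Q)]
  · rw [Fin.succ_last, Fin.snoc_last (α := fun _ => W.Q)]

theorem prefixWeight_support_finite {n : ℕ} (a : Fin n → A) :
    (Function.support (W.prefixWeight a)).Finite := by
  induction n with
  | zero =>
    refine Set.Finite.of_injOn (f := fun ρ : Fin 1 → W.Q => ρ 0)
      (fun ρ h => left_ne_zero_of_mul h) ?_ W.init_finite
    intro ρ _ ρ' _ h
    funext i
    rw [Subsingleton.elim i 0]
    exact h
  | succ n ih =>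
    refine ((ih fun i => a i.castSucc).biUnion (t := fun ρ =>
      (fun p => (Fin.snoc ρ p : Fin (n + 1 + 1) → W.Q)) ''
        {p | W.trans (ρ (Fin.last n)) (a (Fin.last n)) p ≠ 0})
      fun ρ _ => (W.trans_finite _ _).image _).subset fun ρ hρ => ?_
    rw [Function.mem_support, ← Fin.snoc_init_self ρ, prefixWeight_snoc] at hρ
    exact Set.mem_biUnion (x := Fin.init ρ) (left_ne_zero_of_mul hρ)
      ⟨ρ (Fin.last (n + 1)), right_ne_zero_of_mul hρ, Fin.snoc_init_self ρ⟩

theorem linearCombination_ofSupportFinite {α : Type*} {f : α → F}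
    (hf : (Function.support f).Finite) (c : α → F) :
    Finsupp.linearCombination F c (Finsupp.ofSupportFinite f hf) = ∑ᶠ p, f p * c p := by
  rw [Finsupp.linearCombination_apply, Finsupp.sum, finsum_eq_sum_of_support_subset]
  · rfl
  · intro p hp
    rw [Finset.mem_coe, Finsupp.mem_support_iff]
    exact left_ne_zero_of_mul hp

/-- The final weights `c` vary in the induction: splitting off the last letter replaces them by
their pullback along its transitions. -/
theorem finsum_prefixWeight {n : ℕ} (a : Fin n → A) (c : W.Q → F) :
    ∑ᶠ ρ : Fin (n + 1) → W.Q, W.prefixWeight a ρ * c (ρ (Fin.last n)) =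
      Finsupp.linearCombination F c
        (Fin.foldl n (fun x i => W.transLinear (a i) x) W.initVector) := by
  induction n generalizing c with
  | zero =>
    rw [Fin.foldl_zero, initVector, linearCombination_ofSupportFinite,
      ← finsum_comp_equiv (Equiv.funUnique (Fin 1) W.Q)]
    refine finsum_congr fun ρ => ?_
    simp [prefixWeight, Equiv.funUnique]
  | succ n ih =>
    rw [← finsum_comp_equiv ((Equiv.prodComm _ _).trans (Fin.snocEquiv fun _ => W.Q)),
      finsum_curry]
    · rw [Fin.foldl_succ_last]
      have h1 : ∀ y, Finsupp.linearCombination F c (W.transLinear (a (Fin.last n)) y) =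
          Finsupp.linearCombination F (fun q => Finsupp.linearCombination F c
            (W.transVector q (a (Fin.last n)))) y := by
        intro y
        rw [transLinear, Finsupp.apply_linearCombination]
        rfl
      rw [h1, ← ih]
      refine finsum_congr fun ρ => ?_
      rw [transVector, linearCombination_ofSupportFinite, mul_finsum]
      refine finsum_congr fun p => ?_
      change W.prefixWeight a (Fin.snoc ρ p : Fin (n + 1 + 1) → W.Q) *
        c ((Fin.snoc ρ p : Fin (n + 1 + 1) → W.Q) (Fin.last (n + 1))) = _
      rw [prefixWeight_snoc, Fin.snoc_last (α := fun _ => W.Q), mul_assoc]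
    · refine Set.Finite.subset ((W.prefixWeight_support_finite a).preimage
        (((Equiv.prodComm _ _).trans (Fin.snocEquiv fun _ => W.Q)).injective.injOn)) ?_
      intro x hx
      exact left_ne_zero_of_mul hx

/-- The language of a weighted automaton in terms of linear algebra. -/
theorem language_eq (w : List A) : W.language w = Finsupp.linearCombination F W.final
    (w.foldl (fun x a => W.transLinear a x) W.initVector) := by
  have h : w.foldl (fun x a => W.transLinear a x) W.initVector =
      Fin.foldl w.length (fun x i => W.transLinear (w.get i) x) W.initVector := by
    rw [Fin.foldl_eq_finRange_foldl, ← List.foldl_map (f := w.get)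
      (g := fun x a => W.transLinear a x), ← List.ofFn_eq_map, List.ofFn_get]
  rw [h, ← finsum_prefixWeight]
  rfl

end WeightedAutomaton

/-! ### The action on free vector spaces -/

section FreeSpace

variable {G 𝔸 : Type} [Group G] [MulAction G 𝔸] {F X : Type*} [Field F] [MulAction G X]

theorem FreeSpace.smul_apply (g : G) (f : FreeSpace F X) (x : X) :
    (g • f : FreeSpace F X).toFun x = f.toFun (g⁻¹ • x) :=
  Finsupp.comapSMul_apply g f x

theorem FreeSpace.smul_eq_iff (g : G) (f f' : FreeSpace F X) :
    g • f = f' ↔ ∀ x, f'.toFun (g • x) = f.toFun x := by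
  constructor
  · rintro rfl x
    rw [smul_apply, inv_smul_smul]
  · intro h
    refine Finsupp.ext fun x => ?_
    have := h (g⁻¹ • x)
    rw [smul_inv_smul] at this
    exact (smul_apply g f x).trans this.symm

theorem FreeSpace.finitelySupported {f : FreeSpace F X}
    (hf : ∀ x, f.toFun x ≠ 0 → FinitelySupported G 𝔸 x) : FinitelySupported G 𝔸 f := by
  classical
  choose! s hs using hf
  refine ⟨f.support.biUnion s, fun π hπ => ?_⟩
  change Finsupp.mapDomain (π • ·) f = f
  conv_rhs => rw [← Finsupp.mapDomain_id (v := f)]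
  refine Finsupp.mapDomain_congr fun x hx => hs x (Finsupp.mem_support_iff.1 hx) π ?_
  exact fixAtoms_anti (Finset.subset_biUnion_of_mem s hx) hπ

end FreeSpace

/-! ### The free space over the states as a basic automaton -/

namespace WeightedAutomaton

variable {G 𝔸 : Type} [Group G] [MulAction G 𝔸] {F : Type u} [Field F] {X : Type v}
  [MulAction G X] {A : Set X} (W : WeightedAutomaton G 𝔸 F A)

/-- The vectors with coordinates indexed by states. -/
def stateSpace : Set (FreeSpace F W.Amb) := (Finsupp.supported F F W.Q : Set (W.Amb →₀ F))

noncomputable instance : AddCommGroup W.stateSpace :=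
  inferInstanceAs (AddCommGroup (Finsupp.supported F F W.Q))

noncomputable instance : Module F W.stateSpace :=
  inferInstanceAs (Module F (Finsupp.supported F F W.Q))

/-- The coordinates of vectors of the state space. -/
noncomputable def coords : W.stateSpace ≃ₗ[F] (W.Q →₀ F) :=
  Finsupp.supportedEquivFinsupp (M := F) (R := F) W.Q

theorem coords_apply (x : W.stateSpace) (q : W.Q) : W.coords x q = x.1.toFun q := rfl

theorem apply_eq_zero (x : W.stateSpace) {p : W.Amb} (hp : p ∉ W.Q) : x.1.toFun p = 0 := by
  by_contra h
  exact hp ((Finsupp.mem_supported F _).1 x.2 (Finsupp.mem_support_iff.2 h))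

theorem exists_perm : ∃ s : Finset 𝔸, ∀ π ∈ fixAtoms G 𝔸 s, ∃ σ : Equiv.Perm W.Q,
    ∀ q, (σ q : W.Amb) = π • (q : W.Amb) := by
  obtain ⟨s, hs⟩ := W.states_orbitFinite.isSetWithAtoms.finitelySupported
  refine ⟨s, fun π hπ => ⟨⟨fun q => ⟨π • (q : W.Amb), ?_⟩, fun q => ⟨π⁻¹ • (q : W.Amb), ?_⟩,
    fun q => ?_, fun q => ?_⟩, fun q => rfl⟩⟩
  · have := Set.smul_mem_smul_set (a := π) q.2
    rwa [hs π hπ] at this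
  · have := Set.smul_mem_smul_set (a := π⁻¹) q.2
    rwa [hs π⁻¹ (inv_mem hπ)] at this
  · exact Subtype.ext (inv_smul_smul _ _)
  · exact Subtype.ext (smul_inv_smul _ _)

/-- This reduces equivariance on the state space to commutation of linear maps with a permutation of
coordinates, which can be checked on basis vectors. -/
theorem smul_eq_iff_coords {π : G} {σ : Equiv.Perm W.Q}
    (hσ : ∀ q, (σ q : W.Amb) = π • (q : W.Amb)) (x x' : W.stateSpace) :
    π • (x : FreeSpace F W.Amb) = x' ↔ Finsupp.domLCongr (R := F) σ (W.coords x) = W.coords x' := by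
  rw [FreeSpace.smul_eq_iff]
  constructor
  · intro h
    ext q
    have := h (σ.symm q)
    rw [← hσ, Equiv.apply_symm_apply] at this
    exact this.symm
  · intro h p
    by_cases hp : p ∈ W.Q
    · have := DFunLike.congr_fun h (σ ⟨p, hp⟩)
      rw [Finsupp.domLCongr_apply, Finsupp.domCongr_apply, Finsupp.equivMapDomain_apply,
        Equiv.symm_apply_apply, coords_apply, coords_apply, hσ] at this
      exact this.symm
    · have hp' : π • p ∉ W.Q := by
        intro h'
        have h1 := hσ (σ.symm ⟨π • p, h'⟩)
        rw [Equiv.apply_symm_apply, smul_left_cancel_iff] at h1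
        exact hp (h1 ▸ (σ.symm ⟨π • p, h'⟩).2)
      rw [W.apply_eq_zero x hp, W.apply_eq_zero x' hp']

theorem isSetWithAtoms_stateSpace : IsSetWithAtoms G 𝔸 W.stateSpace where
  finitelySupported := by
    obtain ⟨s, hs⟩ := W.exists_perm
    have key : ∀ π ∈ fixAtoms G 𝔸 s, π • W.stateSpace ⊆ W.stateSpace := by
      rintro π hπ _ ⟨x, hx, rfl⟩
      obtain ⟨σ, hσ⟩ := hs π hπ
      have := (W.smul_eq_iff_coords hσ ⟨x, hx⟩
        (W.coords.symm (Finsupp.domLCongr (R := F) σ (W.coords ⟨x, hx⟩)))).2 (by simp)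
      change π • x ∈ W.stateSpace
      rw [this]
      exact Subtype.prop _
    exact ⟨s, fun π hπ => (key π hπ).antisymm
      (Set.subset_smul_set_iff.2 (key π⁻¹ (inv_mem hπ)))⟩
  finitelySupported_mem x hx := FreeSpace.finitelySupported fun p hp =>
    W.states_orbitFinite.isSetWithAtoms.finitelySupported_mem p (by
      by_contra h
      exact hp (W.apply_eq_zero ⟨x, hx⟩ h))

theorem isVectorSpaceWithAtoms_stateSpace : IsVectorSpaceWithAtoms G 𝔸 F W.stateSpace where
  isSetWithAtoms := W.isSetWithAtoms_stateSpace
  add_finitelySupported := by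
    obtain ⟨s, hs⟩ := W.exists_perm
    refine ⟨s, fun π hπ x x' y y' hx hy => ?_⟩
    obtain ⟨σ, hσ⟩ := hs π hπ
    rw [W.smul_eq_iff_coords hσ] at hx hy ⊢
    rw [map_add, map_add, map_add, hx, hy]
  smul_finitelySupported := by
    obtain ⟨s, hs⟩ := W.exists_perm
    refine ⟨s, fun π hπ c x x' hx => ?_⟩
    obtain ⟨σ, hσ⟩ := hs π hπ
    rw [W.smul_eq_iff_coords hσ] at hx ⊢
    rw [map_smul, map_smul, map_smul, hx]

/-- The states as a basis of the state space. -/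
noncomputable def stateBasis : Module.Basis W.Q F W.stateSpace := Module.Basis.ofRepr W.coords

theorem isOrbitFinite_stateBasis :
    IsOrbitFinite G 𝔸 (Subtype.val '' Set.range W.stateBasis) := by
  have h := W.states_orbitFinite.image (Y := FreeSpace F W.Amb)
    (f := fun q => Finsupp.single q (1 : F)) (fun g q => (Finsupp.comapSMul_single g q 1).symm)
  convert h using 1
  ext x
  simp only [Set.mem_image, Set.mem_range, exists_exists_eq_and]
  have h1 : ∀ q : W.Q, ((W.stateBasis q : W.stateSpace) : FreeSpace F W.Amb) =
      Finsupp.single (q : W.Amb) (1 : F) := by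
    intro q
    change (((Finsupp.supportedEquivFinsupp (M := F) (R := F) W.Q).symm (Finsupp.single q 1) :
      Finsupp.supported F F W.Q) : W.Amb →₀ F) = _
    rw [Finsupp.supportedEquivFinsupp_symm_single]
  constructor
  · rintro ⟨q, rfl⟩
    exact ⟨q, q.2, (h1 q).symm⟩
  · rintro ⟨q, hq, rfl⟩
    exact ⟨⟨q, hq⟩, h1 _⟩

/-- The weighted automaton as an orbit-finitely spanned one. -/
noncomputable def toSpanned : SpannedAutomaton G 𝔸 F A where
  Amb := FreeSpace F W.Amb
  V := W.stateSpace
  alphabet_orbitFinite := W.alphabet_orbitFinite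
  orbitFinitelySpanned :=
    ⟨W.isVectorSpaceWithAtoms_stateSpace, _, W.isOrbitFinite_stateBasis, W.stateBasis.span_eq⟩
  trans a := W.coords.symm.toLinearMap ∘ₗ W.transLinear a ∘ₗ W.coords.toLinearMap
  trans_finitelySupported := by
    classical
    obtain ⟨s, hs⟩ := W.exists_perm
    obtain ⟨t, ht⟩ := W.trans_finitelySupported
    refine ⟨s ∪ t, fun π hπ x x' a a' hx ha => ?_⟩
    obtain ⟨σ, hσ⟩ := hs π (fixAtoms_anti Finset.subset_union_left hπ)
    rw [W.smul_eq_iff_coords hσ] at hx ⊢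
    simp only [LinearMap.comp_apply, LinearEquiv.coe_coe, LinearEquiv.apply_symm_apply]
    rw [← hx]
    have : (Finsupp.domLCongr (R := F) σ).toLinearMap ∘ₗ W.transLinear a =
        W.transLinear a' ∘ₗ (Finsupp.domLCongr (R := F) σ).toLinearMap := by
      refine Finsupp.lhom_ext' fun q => LinearMap.ext_ring ?_
      simp only [LinearMap.comp_apply, Finsupp.lsingle_apply, LinearEquiv.coe_coe, transLinear,
        Finsupp.domLCongr_single, Finsupp.linearCombination_single, one_smul]
      ext p
      rw [Finsupp.domLCongr_apply, Finsupp.domCongr_apply, Finsupp.equivMapDomain_apply]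
      refine (ht π (fixAtoms_anti Finset.subset_union_right hπ) q (σ q) a a' (σ.symm p) p
        (hσ q).symm ha ?_).symm
      rw [← hσ, Equiv.apply_symm_apply]
    exact LinearMap.congr_fun this (W.coords x)
  init := W.coords.symm W.initVector
  final := Finsupp.linearCombination F W.final ∘ₗ W.coords.toLinearMap
  final_finitelySupported := by
    classical
    obtain ⟨s, hs⟩ := W.exists_perm
    obtain ⟨t, ht⟩ := W.final_finitelySupported
    refine ⟨s ∪ t, fun π hπ x x' hx => ?_⟩
    obtain ⟨σ, hσ⟩ := hs π (fixAtoms_anti Finset.subset_union_left hπ)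
    rw [W.smul_eq_iff_coords hσ] at hx
    simp only [LinearMap.comp_apply, LinearEquiv.coe_coe]
    rw [← hx]
    have : Finsupp.linearCombination F W.final ∘ₗ (Finsupp.domLCongr (R := F) σ).toLinearMap =
        Finsupp.linearCombination F W.final := by
      refine Finsupp.lhom_ext' fun q => LinearMap.ext_ring ?_
      simp only [LinearMap.comp_apply, Finsupp.lsingle_apply, LinearEquiv.coe_coe,
        Finsupp.domLCongr_single, Finsupp.linearCombination_single, one_smul]
      exact ht π (fixAtoms_anti Finset.subset_union_right hπ) q (σ q) (hσ q).symm
    exact LinearMap.congr_fun this (W.coords x)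

theorem isBasic_toSpanned : W.toSpanned.IsBasic :=
  ⟨_, W.isOrbitFinite_stateBasis, W.stateBasis.linearIndependent.linearIndepOn_id,
    W.stateBasis.span_eq⟩

theorem language_toSpanned : W.toSpanned.language = W.language := by
  funext w
  rw [language_eq]
  change Finsupp.linearCombination F W.final (W.coords (w.foldl _ (W.coords.symm W.initVector))) = _
  congr 1
  have h := List.foldl_hom (W.coords : W.stateSpace → (W.Q →₀ F))
    (g₁ := fun x a => W.toSpanned.trans a x) (g₂ := fun x a => W.transLinear a x) (l := w)
    (init := W.coords.symm W.initVector) (fun x a => by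
      change _ = W.coords (W.coords.symm (W.transLinear a (W.coords x)))
      rw [LinearEquiv.apply_symm_apply])
  rw [LinearEquiv.apply_symm_apply] at h
  exact h.symm

end WeightedAutomaton

/-! ### Inducing actions from subgroups -/

/-- Functions on the group `G`, with the action of `G` by right translations. -/
def RightTranslation (G Y : Type*) : Type _ := G → Option Y

instance {G Y : Type*} [Group G] : MulAction G (RightTranslation G Y) where
  smul h f := fun g => f (g * h)
  one_smul f := funext fun g => congrArg f (mul_one g)
  mul_smul h k f := funext fun g => congrArg f (mul_assoc g h k).symm

namespace RightTranslation

variable {G Y : Type*} [Group G] {Γ : Subgroup G} [MulAction Γ Y]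

open Classical in
/-- The embedding of a set with an action of a subgroup `Γ` into a set with an action of `G`. -/
noncomputable def embed (Γ : Subgroup G) [MulAction Γ Y] (y : Y) : RightTranslation G Y :=
  fun g => if h : g ∈ Γ then some ((⟨g, h⟩ : Γ) • y) else none

theorem smul_embed (h : Γ) (y : Y) : (h : G) • embed Γ y = embed Γ (h • y) := by
  funext g
  change embed Γ y (g * h) = _
  unfold embed
  by_cases hg : g ∈ Γ
  · rw [dif_pos hg, dif_pos (mul_mem hg h.2), ← mul_smul]
    rfl
  · rw [dif_neg hg, dif_neg (by rwa [Γ.mul_mem_cancel_right h.2])]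

theorem embed_one (y : Y) : embed Γ y 1 = some y := by
  unfold embed
  rw [dif_pos (one_mem Γ)]
  exact congrArg some (one_smul Γ y)

/-- Functionals carry an action of the `s`-automorphisms only, while states need one of all of `G`;
the embedding preserves the orbits of the subgroup. -/
theorem isOrbitFinite_embed {G 𝔸 : Type} [Group G] [MulAction G 𝔸] {s : Finset 𝔸}
    [MulAction (fixAtoms G 𝔸 s) Y] {Ψ : Set Y} (hΨ : Ψ.Finite)
    (hfs : ∀ ψ ∈ Ψ, ∃ D : Finset 𝔸, Supports (fixAtoms G 𝔸 s) D ψ) :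
    IsOrbitFinite G 𝔸 (embed (fixAtoms G 𝔸 s) ''
      ⋃ ψ ∈ Ψ, MulAction.orbit (fixAtoms G 𝔸 s) ψ) := by
  classical
  have key : (embed (fixAtoms G 𝔸 s) '' ⋃ ψ ∈ Ψ, MulAction.orbit (fixAtoms G 𝔸 s) ψ) =
      ⋃ x ∈ embed (fixAtoms G 𝔸 s) '' Ψ, MulAction.orbit (fixAtoms G 𝔸 s) x := by
    rw [Set.image_iUnion₂, Set.biUnion_image]
    refine Set.iUnion₂_congr fun ψ _ => ?_
    ext y
    constructor
    · rintro ⟨_, ⟨g, rfl⟩, rfl⟩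
      exact ⟨g, smul_embed g ψ⟩
    · rintro ⟨g, rfl⟩
      exact ⟨_, ⟨g, rfl⟩, (smul_embed g ψ).symm⟩
  refine ⟨⟨⟨s, fun π hπ => ?_⟩, ?_⟩, s, _, hΨ.image _, key⟩
  · rw [key, Set.smul_set_iUnion₂]
    refine Set.iUnion₂_congr fun x _ => ?_
    exact MulAction.smul_orbit (⟨π, hπ⟩ : fixAtoms G 𝔸 s) x
  · rintro _ ⟨y, hy, rfl⟩
    obtain ⟨ψ, hψ, g, rfl⟩ := Set.mem_iUnion₂.1 hy
    obtain ⟨D, hD⟩ := hfs ψ hψ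
    refine ⟨s ∪ g • D, fun π hπ => ?_⟩
    have h1 : π ∈ fixAtoms G 𝔸 s := fixAtoms_anti Finset.subset_union_left hπ
    have h2 := hD.smul g ⟨π, h1⟩ fun a ha => mem_fixAtoms.1 hπ a (Finset.mem_union_right _ ha)
    exact (smul_embed (⟨π, h1⟩ : fixAtoms G 𝔸 s) (g • ψ)).trans (congrArg _ h2)

end RightTranslation

/-! ### Reversing spanned automata -/

namespace SpannedAutomaton

variable {G 𝔸 : Type} [Group G] [MulAction G 𝔸] {F : Type u} [Field F] {X : Type v}
  [MulAction G X] {A : Set X}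

/-- `s` supports all parts of the automaton `M`. -/
structure IsSupport (M : SpannedAutomaton G 𝔸 F A) (s : Finset 𝔸) : Prop where
  smul_mem : ∀ π ∈ fixAtoms G 𝔸 s, ∀ x ∈ M.V, π • x ∈ M.V
  add : ∀ π ∈ fixAtoms G 𝔸 s, ∀ x x' y y' : M.V, π • (x : M.Amb) = x' → π • (y : M.Amb) = y' →
    π • ((x + y : M.V) : M.Amb) = (x' + y' : M.V)
  smul : ∀ π ∈ fixAtoms G 𝔸 s, ∀ (c : F) (x x' : M.V), π • (x : M.Amb) = x' →
    π • ((c • x : M.V) : M.Amb) = (c • x' : M.V)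
  trans : ∀ π ∈ fixAtoms G 𝔸 s, ∀ (x x' : M.V) (a a' : A), π • (x : M.Amb) = x' →
    π • (a : X) = a' → π • (M.trans a x : M.Amb) = M.trans a' x'
  init : ∀ π ∈ fixAtoms G 𝔸 s, π • (M.init : M.Amb) = M.init
  final : ∀ π ∈ fixAtoms G 𝔸 s, ∀ x x' : M.V, π • (x : M.Amb) = x' → M.final x' = M.final x

theorem exists_isSupport (M : SpannedAutomaton G 𝔸 F A) : ∃ s, M.IsSupport s := by
  classical
  obtain ⟨⟨⟨⟨s₁, h₁⟩, hmem⟩, ⟨s₂, h₂⟩, ⟨s₃, h₃⟩⟩, -⟩ := M.orbitFinitelySpanned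
  obtain ⟨s₄, h₄⟩ := M.trans_finitelySupported
  obtain ⟨s₅, h₅⟩ := hmem _ M.init.2
  obtain ⟨s₆, h₆⟩ := M.final_finitelySupported
  refine ⟨s₁ ∪ s₂ ∪ s₃ ∪ s₄ ∪ s₅ ∪ s₆, fun π hπ x hx => ?_, fun π hπ => h₂ π ?_,
    fun π hπ => h₃ π ?_, fun π hπ => h₄ π ?_, fun π hπ => h₅ π ?_, fun π hπ => h₆ π ?_⟩
  · have := Set.smul_mem_smul_set (a := π) hx
    rwa [h₁ π (fixAtoms_anti (by intro a ha; simp [ha]) hπ)] at this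
  all_goals exact fixAtoms_anti (by intro a ha; simp [ha]) hπ

namespace IsSupport

variable {M : SpannedAutomaton G 𝔸 F A} {s : Finset 𝔸} (h : M.IsSupport s)

/-- The action on the state space of the automorphisms that fix the constants. -/
@[reducible]
def action : DistribMulAction (fixAtoms G 𝔸 s) M.V where
  smul π x := ⟨(π : G) • (x : M.Amb), h.smul_mem π π.2 x x.2⟩
  one_smul x := Subtype.ext (one_smul G (x : M.Amb))
  mul_smul π ρ x := Subtype.ext (mul_smul (π : G) (ρ : G) (x : M.Amb))
  smul_zero π := by
    have := h.smul π π.2 0 0 ⟨_, h.smul_mem π π.2 _ (0 : M.V).2⟩ rfl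
    rw [zero_smul, zero_smul] at this
    exact Subtype.ext this
  smul_add π x y := Subtype.ext (h.add π π.2 x ⟨_, h.smul_mem π π.2 x x.2⟩ y
    ⟨_, h.smul_mem π π.2 y y.2⟩ rfl rfl)

theorem smulCommClass : @SMulCommClass (fixAtoms G 𝔸 s) F M.V h.action.toSMul _ :=
  @SMulCommClass.mk _ _ _ h.action.toSMul _ fun π c x => Subtype.ext
    (h.smul π π.2 c x ⟨_, h.smul_mem π π.2 x x.2⟩ rfl)

end IsSupport

/-- The functionals on spaces that are spanned by vectors with bounded supports have
decompositions. -/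
def DualsDecompose (G 𝔸 : Type) [Group G] [MulAction G 𝔸] [DecidableEq 𝔸] (F : Type u)
    [Field F] : Prop :=
  ∀ (s : Finset 𝔸) (V : Type u) [AddCommGroup V] [Module F V]
    [DistribMulAction (fixAtoms G 𝔸 s) V] [SMulCommClass (fixAtoms G 𝔸 s) F V] (k : ℕ),
    (∀ v : V, ∃ u : Finset 𝔸, Supports (fixAtoms G 𝔸 s) u v) →
    Submodule.span F {v : V | ∃ u : Finset 𝔸, u.card ≤ k ∧
      Supports (fixAtoms G 𝔸 s) u v} = ⊤ →
    ∃ k', HasDecomposition (fixAtoms G 𝔸 s) 𝔸 F V k'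

variable [DecidableEq 𝔸] {R : 𝔸 → 𝔸 → Prop}

/-- The spanning set consists of orbits for some `t` unrelated to `s`; each is covered by finitely
many orbits of `s`-automorphisms. -/
theorem IsSupport.exists_finite_generators {M : SpannedAutomaton G 𝔸 F A} {s : Finset 𝔸}
    (h : M.IsSupport s) (H : Homogeneous G R ∅) :
    let _ := h.action
    ∃ T : Set M.V, T.Finite ∧
      Submodule.span F (⋃ v ∈ T, MulAction.orbit (fixAtoms G 𝔸 s) v) = ⊤ := by
  intro _
  obtain ⟨-, S, ⟨⟨-, hSfs⟩, t, T₀, hT₀, hS⟩, hspan⟩ := M.orbitFinitelySpanned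
  have hmem : ∀ x ∈ T₀, MulAction.orbit (fixAtoms G 𝔸 t) x ⊆ Subtype.val '' S := fun x hx => by
    rw [hS]
    exact Set.subset_biUnion_of_mem (u := fun x => MulAction.orbit (fixAtoms G 𝔸 t) x) hx
  have key : ∀ x ∈ T₀, ∃ T : Set M.Amb, T.Finite ∧ T ⊆ MulAction.orbit (fixAtoms G 𝔸 t) x ∧
      ∀ z ∈ MulAction.orbit (fixAtoms G 𝔸 t) x, ∃ y ∈ T, ∃ σ : G,
        (∀ d ∈ s, σ • d = d) ∧ z = σ • y := by
    intro x hx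
    obtain ⟨u, hu⟩ := hSfs x (hmem x hx (MulAction.mem_orbit_self x))
    refine H.exists_finite_orbit_reps (u := u) (fun π hπ => hu π (mem_fixAtoms.2 hπ)) s _ ?_
    rintro _ ⟨g, rfl⟩
    exact ⟨g, rfl⟩
  choose! T hT hTx hTz using key
  refine ⟨Subtype.val ⁻¹' ⋃ x ∈ T₀, T x,
    (hT₀.biUnion hT).preimage Subtype.val_injective.injOn, ?_⟩
  rw [eq_top_iff, ← hspan]
  refine Submodule.span_mono fun v hv => ?_
  have hv' : (v : M.Amb) ∈ Subtype.val '' S := Set.mem_image_of_mem _ hv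
  rw [hS] at hv'
  obtain ⟨x, hx, hvx⟩ := Set.mem_iUnion₂.1 hv'
  obtain ⟨y, hy, σ, hσ, hvy⟩ := hTz x hx v hvx
  obtain ⟨y', -, rfl⟩ := hmem x hx (hTx x hx hy)
  exact Set.mem_iUnion₂.2 ⟨y', Set.mem_iUnion₂.2 ⟨x, hx, hy⟩, ⟨σ, mem_fixAtoms.2 hσ⟩,
    Subtype.ext hvy.symm⟩

theorem exists_reverse (M : SpannedAutomaton G 𝔸 F A) (H : Homogeneous G R ∅)
    (hdec : DualsDecompose G 𝔸 F) :
    ∃ W : WeightedAutomaton G 𝔸 F A, ∀ w, W.language w = M.language w.reverse := by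
  classical
  obtain ⟨s, h⟩ := M.exists_isSupport
  obtain ⟨T, hT, hspan⟩ := h.exists_finite_generators H
  let _ := h.action
  have := h.smulCommClass
  have hfs : ∀ v : M.V, ∃ u : Finset 𝔸, Supports (fixAtoms G 𝔸 s) u v := fun v => by
    obtain ⟨u, hu⟩ :=
      M.orbitFinitelySpanned.isVectorSpaceWithAtoms.isSetWithAtoms.finitelySupported_mem v v.2
    exact ⟨u, fun π hπ => Subtype.ext (hu π (mem_fixAtoms.2 hπ))⟩
  obtain ⟨k, hk⟩ : ∃ k : ℕ, Submodule.span F {v : M.V | ∃ u : Finset 𝔸, u.card ≤ k ∧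
      Supports (fixAtoms G 𝔸 s) u v} = ⊤ := by
    choose S hS using hfs
    refine ⟨hT.toFinset.sup fun v => (S v).card, ?_⟩
    rw [eq_top_iff, ← hspan]
    refine Submodule.span_mono fun w hw => ?_
    obtain ⟨v, hv, g, rfl⟩ := Set.mem_iUnion₂.1 hw
    refine ⟨g • S v, ?_, (hS v).smul g⟩
    rw [Finset.card_smul_finset]
    exact Finset.le_sup (f := fun v => (S v).card) (hT.mem_toFinset.2 hv)
  obtain ⟨k', hk'⟩ := hdec s M.V k hfs hk
  obtain ⟨Ψ, hΨ, hΨs, l, hl, hlπ⟩ := (H.fixAtoms s).exists_equivariant_lift hfs hT hspan hk'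
  let P : Set (Module.Dual F M.V) := ⋃ ψ ∈ Ψ, MulAction.orbit (fixAtoms G 𝔸 s) ψ
  have hPs : ∀ p ∈ P, ∃ t : Finset 𝔸, Supports (fixAtoms G 𝔸 s) t p := by
    intro p hp
    obtain ⟨ψ, hψ, g, rfl⟩ := Set.mem_iUnion₂.1 hp
    obtain ⟨D, hD⟩ := hΨs ψ hψ
    exact ⟨_, hD.smul g⟩
  let Q : Set (RightTranslation G (Module.Dual F M.V)) :=
    RightTranslation.embed (fixAtoms G 𝔸 s) '' P
  -- The value of an embedded functional at `1` is the functional itself; the default `0` never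
  -- occurs.
  let d : Q → Module.Dual F M.V := fun q => (q.1 1).getD 0
  have hd : ∀ (q : Q) (p : Module.Dual F M.V),
      RightTranslation.embed (fixAtoms G 𝔸 s) p = q → d q = p := by
    intro q p hq
    change (q.1 1).getD 0 = p
    rw [← hq, RightTranslation.embed_one]
    rfl
  have hdP : ∀ q, d q ∈ P ∧ RightTranslation.embed (fixAtoms G 𝔸 s) (d q) = q := by
    intro q
    obtain ⟨p, hp, hpq⟩ := q.2
    rw [hd q p hpq]
    exact ⟨hp, hpq⟩
  have hdinj : Function.Injective d := fun q q' hq => Subtype.ext (by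
    rw [← (hdP q).2, hq, (hdP q').2])
  have hdsmul : ∀ (π : fixAtoms G 𝔸 s) (q q' : Q),
      (π : G) • (q : RightTranslation G (Module.Dual F M.V)) = q' → d q' = π • d q := by
    intro π q q' hq
    apply hd
    rw [← RightTranslation.smul_embed, (hdP q).2, hq]
  have hlsmul : ∀ (π : fixAtoms G 𝔸 s) (φ p : Module.Dual F M.V),
      l (π • φ) (π • p) = l φ p := by
    intro π φ p
    rw [hlπ]
    exact Finsupp.mapDomain_apply (MulAction.injective π) _ _
  have hlfin : ∀ φ, {q : Q | l φ (d q) ≠ 0}.Finite := fun φ =>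
    ((l φ).support.finite_toSet.preimage hdinj.injOn).subset fun q hq =>
      Finsupp.mem_support_iff.2 hq
  have hfinal : ∀ π : fixAtoms G 𝔸 s, π • M.final = M.final := by
    intro π
    ext v
    have := h.final π π.2 (π⁻¹ • v) v (congrArg Subtype.val (smul_inv_smul π v))
    rw [dual_smul_apply, this]
  have htrans : ∀ (π : fixAtoms G 𝔸 s) (φ : Module.Dual F M.V) (a a' : A),
      (π : G) • (a : X) = a' → (π • φ) ∘ₗ M.trans a' = π • (φ ∘ₗ M.trans a) := by
    intro π φ a a' ha
    ext v
    rw [LinearMap.comp_apply, dual_smul_apply, dual_smul_apply, LinearMap.comp_apply]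
    have h1 : π • M.trans a (π⁻¹ • v) = M.trans a' v := Subtype.ext
      (h.trans π π.2 _ v a a' (congrArg Subtype.val (smul_inv_smul π v)) ha)
    rw [← h1, inv_smul_smul]
  have htransfs : ∀ φ ∈ P, ∀ a, ∃ t : Finset 𝔸, Supports (fixAtoms G 𝔸 s) t (φ ∘ₗ M.trans a) := by
    intro φ hφ a
    obtain ⟨t, ht⟩ := hPs φ hφ
    obtain ⟨t', ht'⟩ := M.alphabet_orbitFinite.isSetWithAtoms.finitelySupported_mem a a.2
    refine ⟨t ∪ t', fun π hπ => ?_⟩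
    rw [← htrans π φ a a (ht' π (mem_fixAtoms.2 fun b hb => hπ b (Finset.mem_union_right _ hb))),
      ht π fun b hb => hπ b (Finset.mem_union_left _ hb)]
  let W : WeightedAutomaton G 𝔸 F A :=
    { Amb := RightTranslation G (Module.Dual F M.V)
      Q := Q
      alphabet_orbitFinite := M.alphabet_orbitFinite
      states_orbitFinite := RightTranslation.isOrbitFinite_embed hΨ hΨs
      init := fun q => l M.final (d q)
      trans := fun q a p => l (d q ∘ₗ M.trans a) (d p)
      final := fun q => d q M.init
      init_finitelySupported := ⟨s, fun π hπ q q' hq => by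
        have h1 := hlsmul ⟨π, hπ⟩ M.final (d q)
        rw [hfinal] at h1
        rw [hdsmul ⟨π, hπ⟩ q q' hq, h1]⟩
      trans_finitelySupported := ⟨s, fun π hπ q q' a a' p p' hq ha hp => by
        rw [hdsmul ⟨π, hπ⟩ q q' hq, hdsmul ⟨π, hπ⟩ p p' hp, htrans ⟨π, hπ⟩ _ a a' ha, hlsmul]⟩
      final_finitelySupported := ⟨s, fun π hπ q q' hq => by
        rw [hdsmul ⟨π, hπ⟩ q q' hq, dual_smul_apply]
        refine congrArg (d q) (inv_smul_eq_iff.2 (Subtype.ext (h.init π hπ).symm))⟩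
      init_finite := hlfin M.final
      trans_finite := fun q a => hlfin (d q ∘ₗ M.trans a) }
  refine ⟨W, fun w => ?_⟩
  -- Evaluating formal combinations of states as functionals undoes the lift. Hence this evaluation
  -- is a linear map intertwining the runs of `W` with pullback along the transitions of `M`.
  have hev : ∀ (φ : Module.Dual F M.V) (x : Q →₀ F),
      (∃ t : Finset 𝔸, Supports (fixAtoms G 𝔸 s) t φ) → (∀ q, x q = l φ (d q)) →
      Finsupp.linearCombination F d x = φ := by
    intro φ x hφ hx
    have h1 : x.mapDomain d = l φ := by
      ext p
      by_cases hp : p ∈ P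
      · have h2 : d ⟨_, Set.mem_image_of_mem _ hp⟩ = p := hd _ _ rfl
        rw [← h2, Finsupp.mapDomain_apply hdinj, hx]
      · rw [Finsupp.mapDomain_of_notMem_range]
        · by_contra hne
          exact hp ((hl φ hφ).1 (Finsupp.mem_support_iff.2 (Ne.symm hne)))
        · rintro ⟨q, rfl⟩
          exact hp (hdP q).1
    have h2 := (hl φ hφ).2
    rw [← h1, Finsupp.linearCombination_mapDomain] at h2
    exact h2
  have hinit : Finsupp.linearCombination F d W.initVector = M.final :=
    hev _ _ ⟨∅, fun π _ => hfinal π⟩ fun _ => rfl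
  have hstep : ∀ (x : Q →₀ F) (a : A), Finsupp.linearCombination F d (W.transLinear a x) =
      Finsupp.linearCombination F d x ∘ₗ M.trans a := by
    intro x a
    have h1 : Finsupp.linearCombination F d ∘ₗ W.transLinear a =
        (LinearMap.lcomp F F (M.trans a)) ∘ₗ Finsupp.linearCombination F d := by
      refine Finsupp.lhom_ext' fun q => LinearMap.ext_ring ?_
      simp only [LinearMap.comp_apply, Finsupp.lsingle_apply, Finsupp.linearCombination_single,
        WeightedAutomaton.transLinear, one_smul]
      exact hev _ _ (htransfs _ (hdP q).1 a) fun _ => rfl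
    exact LinearMap.congr_fun h1 x
  have hfold : ∀ (w : List A) (φ : Module.Dual F M.V) (v : M.V),
      w.foldl (fun φ a => φ ∘ₗ M.trans a) φ v =
        φ (w.reverse.foldl (fun x a => M.trans a x) v) := by
    intro w
    induction w with
    | nil => exact fun _ _ => rfl
    | cons a w ih =>
      intro φ v
      rw [List.foldl_cons, ih, List.reverse_cons, List.foldl_append]
      rfl
  have hout : ∀ x : Q →₀ F, Finsupp.linearCombination F W.final x =
      Finsupp.linearCombination F d x M.init := by
    intro x
    simp only [Finsupp.linearCombination_apply, Finsupp.sum, LinearMap.sum_apply,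
      LinearMap.smul_apply]
    rfl
  rw [W.language_eq]
  refine (hout _).trans ?_
  have h1 := List.foldl_hom (Finsupp.linearCombination F d) (g₁ := fun x a => W.transLinear a x)
    (g₂ := fun φ a => φ ∘ₗ M.trans a) (l := w) (init := W.initVector)
    (fun x a => (hstep x a).symm)
  rw [← h1, hinit, hfold]
  rfl

/-- Reversal is applied twice, with the weighted automaton viewed as a spanned one in between. -/
theorem exists_weighted (M : SpannedAutomaton G 𝔸 F A) (H : Homogeneous G R ∅)
    (hdec : DualsDecompose G 𝔸 F) :
    ∃ W : WeightedAutomaton G 𝔸 F A, W.language = M.language := by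
  obtain ⟨W, hW⟩ := M.exists_reverse H hdec
  obtain ⟨W', hW'⟩ := W.toSpanned.exists_reverse H hdec
  refine ⟨W', funext fun w => ?_⟩
  rw [hW', W.language_toSpanned, hW, List.reverse_reverse]

theorem spanned_iff_weighted (H : Homogeneous G R ∅) (hdec : DualsDecompose G 𝔸 F) :
    (∀ L : List A → F, (∃ M : SpannedAutomaton G 𝔸 F A, M.language = L) ↔
      ∃ W : WeightedAutomaton G 𝔸 F A, W.language = L) ∧
    ∀ M : SpannedAutomaton G 𝔸 F A, ∃ M' : SpannedAutomaton G 𝔸 F A,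
      M'.IsBasic ∧ M'.language = M.language := by
  refine ⟨fun L => ⟨?_, ?_⟩, fun M => ?_⟩
  · rintro ⟨M, rfl⟩
    exact M.exists_weighted H hdec
  · rintro ⟨W, rfl⟩
    exact ⟨W.toSpanned, W.language_toSpanned⟩
  · obtain ⟨W, hW⟩ := M.exists_weighted H hdec
    exact ⟨W.toSpanned, W.isBasic_toSpanned, W.language_toSpanned.trans hW⟩

end SpannedAutomaton

/-! ### The two kinds of atoms -/

theorem dualsDecompose_perm_nat (F : Type u) [Field F] :
    SpannedAutomaton.DualsDecompose (Equiv.Perm ℕ) ℕ F :=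
  fun s _ _ _ _ _ k hfs hk =>
    ⟨k, hasDecomposition_of_eq (homogeneous_perm_nat.fixAtoms s) hfs hk⟩

theorem dualsDecompose_orderIso_rat (F : Type u) [Field F] :
    SpannedAutomaton.DualsDecompose (ℚ ≃o ℚ) ℚ F :=
  fun s _ _ _ _ _ k hfs hk =>
    ⟨2 * k + 1, hasDecomposition_of_le (homogeneous_orderIso_rat.fixAtoms s) hfs hk⟩

end AtomSets

theorem mainTheorem7 (F : Type u) [Field F] :
    -- the equality atoms
    (∀ (X : Type v) [MulAction (Equiv.Perm ℕ) X] (A : Set X),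
      (∀ L : List A → F,
        (∃ M : AtomSets.SpannedAutomaton (Equiv.Perm ℕ) ℕ F A, M.language = L) ↔
          ∃ W : AtomSets.WeightedAutomaton (Equiv.Perm ℕ) ℕ F A, W.language = L) ∧
      ∀ M : AtomSets.SpannedAutomaton (Equiv.Perm ℕ) ℕ F A,
        ∃ M' : AtomSets.SpannedAutomaton (Equiv.Perm ℕ) ℕ F A,
          M'.IsBasic ∧ M'.language = M.language) ∧
    -- the ordered atoms
    (∀ (X : Type v) [MulAction (ℚ ≃o ℚ) X] (A : Set X),
      (∀ L : List A → F,
        (∃ M : AtomSets.SpannedAutomaton (ℚ ≃o ℚ) ℚ F A, M.language = L) ↔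
          ∃ W : AtomSets.WeightedAutomaton (ℚ ≃o ℚ) ℚ F A, W.language = L) ∧
      ∀ M : AtomSets.SpannedAutomaton (ℚ ≃o ℚ) ℚ F A,
        ∃ M' : AtomSets.SpannedAutomaton (ℚ ≃o ℚ) ℚ F A,
          M'.IsBasic ∧ M'.language = M.language) := by
  exact ⟨fun X _ A => AtomSets.SpannedAutomaton.spanned_iff_weighted
      AtomSets.homogeneous_perm_nat (AtomSets.dualsDecompose_perm_nat F),
    fun X _ A => AtomSets.SpannedAutomaton.spanned_iff_weighted
      AtomSets.homogeneous_orderIso_rat (AtomSets.dualsDecompose_orderIso_rat F)⟩
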